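/- Notation. A finite simple graph $G$ on a vertex set $V$ is a *threshold graph* if there are real weights $(w_v)_{v\in V}$ and a real $t$ such that distinct $u,v$ are adjacent iff $w_u+w_v>t$. Write $v(G)$ for the number of vertices. The (normalized) degree distribution $\nu(G)$ is the distribution of $d_G(v)/v(G)$ for a uniformly random vertex $v$, a probability measure on $[0,1]$. For finite graphs $F,G$, let $t(F,G)$ be the proportion of maps $V(F)\to V(G)$ that are graph homomorphisms. Embed the set $\mathcal U$ of unlabeled finite non-empty graphs in the product space $\mathbb R^{\{F\}}\times\mathbb R$ by $G\mapsto\big((t(F,G))_F,\,1/v(G)\big)$, and let $\overline{\mathcal U}$ be the closure of its image; $\mathcal U_\infty=\overline{\mathcal U}\setminus\mathcal U$ is the set of graph limits. Let $\mathcal T_\infty$ be the set of those graph limits that lie in the closure of the set of threshold graphs. For a symmetric measurable $W:[0,1]^2\to[0,1]$, $\Gamma_W\in\mathcal U_\infty$ is the graph limit with $t(F,\Gamma_W)=\int\prod_{ij\in E(F)}W(x_i,x_j)\,dx$ for every $F$ (and $1/v$-coordinate $0$). For a probability measure $\mu$ on $[0,1]$, let $S_\mu=\{(x,y)\in[0,1]^2: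 x\ge\mu[0,1-y)\}$; if $S_\mu$ is invariant under $(x,y)\mapsto(y,x)$, let $\Gamma_\mu=\Gamma_{W_\mu}$ with $W_\mu=\mathbf 1_{S_\mu}$. Theorem. Let $0\le p\le1$. Let $T_{1,p}$ be a single vertex, and for $n\ge1$ let $T_{n+1,p}$ be obtained from $T_{n,p}$ by adding a new vertex, which is dominating (adjacent to all previous vertices) with probability $p$ and isolated with probability $1-p$, independently for all the added vertices. Then, as $n\to\infty$, the degree distribution $\nu(T_{n,p})$ converges weakly, almost surely, to a probability measure $\mu_p$ on $[0,1]$. For $0<p<1$, $\mu_p$ has the constant density $(1-p)/p$ on $(0,p)$ and $p/(1-p)$ on $(p,1)$; $\mu_0$ is the point mass at $0$ and $\mu_1$ is the point mass at $1$. In particular, $\mu_{1/2}$ is the uniform distribution on $[0,1]$. Consequently, $S_{\mu_p}$ is symmetric, $\Gamma_{\mu_p}\in\mathcal T_\infty$, and $T_{n,p}\to\Gamma_{\mu_p}$ in $\overline{\mathcal U}$ almost surely. -/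

import Mathlib

open MeasureTheory ProbabilityTheory Filter Topology Set
open scoped unitInterval

noncomputable section

namespace ThresholdLimit

/-! ### Threshold graphs and the sequential model -/

/-- `G` is a threshold graph: there are real vertex weights and a threshold `t` such that two
distinct vertices are adjacent exactly when the sum of their weights exceeds `t`. -/
def IsThreshold {V : Type*} (G : SimpleGraph V) : Prop :=
  ∃ (w : V → ℝ) (t : ℝ), ∀ i j : V, i ≠ j → (G.Adj i j ↔ t < w i + w j)

/-- Add to a graph on `n` vertices a new last vertex, which is dominating (adjacent to all
previous vertices) if `dom = true` and isolated if `dom = false`. -/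
def addVertex {n : ℕ} (G : SimpleGraph (Fin n)) (dom : Bool) : SimpleGraph (Fin (n + 1)) :=
  SimpleGraph.fromRel fun i j : Fin (n + 1) =>
    (∃ i' j' : Fin n, i = i'.castSucc ∧ j = j'.castSucc ∧ G.Adj i' j') ∨
      (j = Fin.last n ∧ dom = true)

/-- The sequentially built graph: start with a single vertex; the `k`-th addition of a vertex
(`k = 0, 1, …`) is dominating iff `dom k = true`. After `n` additions there are `n + 1` vertices. -/
def seqGraph (dom : ℕ → Bool) : (n : ℕ) → SimpleGraph (Fin (n + 1))
  | 0 => ⊥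
  | n + 1 => addVertex (seqGraph dom n) (dom n)

/-! ### Degree distributions -/

open Classical in
/-- The normalized degree `d(v) / v(G)`, as a point of `[0,1]`. -/
def normDegree {V : Type*} [Fintype V] (G : SimpleGraph V) (v : V) : I :=
  ⟨(G.degree v : ℝ) / Fintype.card V, by
    constructor
    · positivity
    · exact div_le_one_of_le₀ (by exact_mod_cast (G.degree_lt_card_verts v).le) (by positivity)⟩

/-- The normalized degree distribution `ν(G)`: the empirical distribution of the normalized
degrees of the vertices of `G`. -/
def degreeDist {V : Type*} [Fintype V] [Nonempty V] (G : SimpleGraph V) :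
    ProbabilityMeasure I :=
  ⟨(Fintype.card V : ENNReal)⁻¹ • ∑ v : V, Measure.dirac (normDegree G v), ⟨by
    simp [ENNReal.inv_mul_cancel]⟩⟩

/-! ### Graph limits -/

/-- `t(F,G)`: the proportion of maps `V(F) → V(G)` that are graph homomorphisms. -/
def homDensity {U V : Type*} [Fintype U] [Fintype V]
    (F : SimpleGraph U) (G : SimpleGraph V) : ℝ :=
  (Nat.card (F →g G) : ℝ) / (Fintype.card V : ℝ) ^ Fintype.card U

/-- The (metrizable) ambient space of the compactification: one coordinate for each finite test
graph `F`, carrying `t(F, ·)`, and one more carrying `1 / v(·)`; with the product topology. -/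
abbrev Profile : Type := ((Σ k : ℕ, SimpleGraph (Fin k)) → ℝ) × ℝ

/-- The embedding of finite graphs into the ambient space. Two nonempty finite graphs have the same
image iff they are isomorphic, so the image of a graph is the corresponding unlabeled graph. -/
def profile {V : Type*} [Fintype V] (G : SimpleGraph V) : Profile :=
  (fun F => homDensity F.2 G, (Fintype.card V : ℝ)⁻¹)

/-- The set `𝒰` of unlabeled graphs with at least one vertex. -/
def graphs : Set Profile := {x | ∃ (n : ℕ) (G : SimpleGraph (Fin (n + 1))), x = profile G}

/-- The compact space `closure 𝒰` of unlabeled graphs and their limits. -/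
def graphsClosure : Set Profile := closure graphs

/-- The set of graph limits: `closure 𝒰` without `𝒰`. -/
def graphLimits : Set Profile := graphsClosure \ graphs

/-- The set `𝒯` of unlabeled threshold graphs. -/
def thresholdGraphs : Set Profile :=
  {x | ∃ (n : ℕ) (G : SimpleGraph (Fin (n + 1))), IsThreshold G ∧ x = profile G}

/-- The set of threshold graph limits: the graph limits that lie in the closure of `𝒯`. -/
def thresholdLimits : Set Profile := closure thresholdGraphs ∩ graphLimits

/-- Symmetric measurable functions `W : [0,1]² → [0,1]`. -/
structure Graphon where
  toFun : I → I → I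
  measurable' : Measurable (Function.uncurry toFun)
  symm' : ∀ x y, toFun x y = toFun y x

open Classical in
/-- `t(F,Γ_W) = ∫ ∏_{ij ∈ E(F)} W(x_i, x_j) dx`. -/
def Graphon.homDensity (W : Graphon) {k : ℕ} (F : SimpleGraph (Fin k)) : ℝ :=
  ∫ x : Fin k → I,
    ∏ e : Fin k × Fin k with e.1 < e.2 ∧ F.Adj e.1 e.2, (W.toFun (x e.1) (x e.2) : ℝ)

/-- The graph limit `Γ_W`; its coordinate `1 / v` is `0`. -/
def Graphon.limit (W : Graphon) : Profile := (fun F => W.homDensity F.2, 0)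

/-! ### The threshold graph limit with a given degree distribution -/

/-- `F_μ(x-) = μ [0,x)`. -/
def leftCDF (μ : ProbabilityMeasure I) (x : I) : ℝ := (μ : Measure I).real (Iio x)

/-- `S_μ = {(x,y) ∈ [0,1]² : x ≥ F_μ((1-y)-)}`. -/
def setS (μ : ProbabilityMeasure I) : Set (I × I) :=
  {z | leftCDF μ (unitInterval.symm z.2) ≤ (z.1 : ℝ)}

/-- The set of probability measures on `[0,1]` that are symmetric in the sense that `S_μ` is
invariant under reflection in the main diagonal. -/
def symmMeasures : Set (ProbabilityMeasure I) :=
  {μ | ∀ x y : I, (x, y) ∈ setS μ ↔ (y, x) ∈ setS μ}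

theorem measurableSet_setS (μ : ProbabilityMeasure I) : MeasurableSet (setS μ) := by
  have hm : Monotone (leftCDF μ) := fun a b h =>
    measureReal_mono (Iio_subset_Iio h) (measure_ne_top _ _)
  have hs : Measurable (unitInterval.symm : I → I) := unitInterval.continuous_symm.measurable
  exact measurableSet_le (hm.measurable.comp (hs.comp measurable_snd))
    (measurable_subtype_coe.comp measurable_fst)

open Classical in
/-- `W_μ`, the indicator function of `S_μ`. -/
def graphonOf (μ : ProbabilityMeasure I) (hμ : μ ∈ symmMeasures) : Graphon where
  toFun x y := if (x, y) ∈ setS μ then 1 else 0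
  measurable' := Measurable.ite (measurableSet_setS μ) measurable_const measurable_const
  symm' x y := by simp only [hμ x y]

/-- `Γ_μ = Γ_{W_μ}`. -/
def limitOf (μ : ProbabilityMeasure I) (hμ : μ ∈ symmMeasures) : Profile := (graphonOf μ hμ).limit

end ThresholdLimit

end

namespace ThresholdLimit

/-! ### Weighted Riemann sums -/

/-! Give vertex `i` of a graph on `N` vertices the arrival point `(i / N, type)`, with type `1` for
dominating and `0` for isolated. Adjacency depends only on arrival points: two vertices are joined
iff the later one is dominating. Randomness enters only through the strong law for the types
(`ae_tendsto_average`); the rest is deterministic along any sequence whose types have average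
tending to `p`. Abel summation against Lipschitz functions then shows that the empirical law of the
arrival points tends to uniform × Bernoulli(`p`) (`tendsto_empirical_arrivalPoint`).

Degrees: a vertex sees all earlier vertices if it is dominating, and every later dominating vertex,
so its normalized degree is uniformly close to `t * u + p * (1 - u)`. Hence μ_p is the image of the
arrival law under `limitDegree`. Isolated vertices (mass `1 - p`) spread uniformly over `(0, p)` and
dominating ones (mass `p`) over `(p, 1)`, which gives the two densities.

Graph limit: the density of `F` is the mass that the product empirical law gives to an open set of
tuples, `homSet F`, whose frontier is null for the limiting product law, so the portmanteau theorem
applies. The measure-preserving map `rank` carries the arrival law to the uniform law and turns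
membership in `S_μ` into adjacency outside a null set (`rank_mem_setS_iff_arrivalRel`), which
identifies the limit as Γ_μ. -/

theorem eventually_forall_abs_le {E : ℕ → ℝ} (h : Tendsto (fun n : ℕ => E n / n) atTop (𝓝 0))
    {ε : ℝ} (hε : 0 < ε) : ∀ᶠ N : ℕ in atTop, ∀ i ≤ N, |E i| ≤ ε * N := by
  have h1 : ∀ᶠ n : ℕ in atTop, |E n / n| < ε := by
    have := (h.abs).eventually (gt_mem_nhds (by simpa using hε : |(0 : ℝ)| < ε))
    exact this
  obtain ⟨n₀, hn₀⟩ := eventually_atTop.1 h1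
  -- For `N ≥ K`, `ε * N` dominates each of the finitely many `|E i|` with `i ≤ n₀`; larger `i`
  -- satisfy `|E i| ≤ ε * i ≤ ε * N`.
  obtain ⟨K, hK⟩ := exists_nat_ge ((∑ i ∈ Finset.range (n₀ + 1), |E i|) / ε)
  filter_upwards [eventually_ge_atTop K] with N hN i hi
  have hKN : (K : ℝ) ≤ N := by exact_mod_cast hN
  by_cases hin : n₀ + 1 ≤ i
  · have hi' : (0 : ℝ) < i := by exact_mod_cast (by omega : 0 < i)
    have := hn₀ i (by omega)
    rw [abs_div, Nat.abs_cast, div_lt_iff₀ hi'] at this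
    refine this.le.trans ?_
    gcongr
  · have : |E i| ≤ ∑ i ∈ Finset.range (n₀ + 1), |E i| :=
      Finset.single_le_sum (f := fun i => |E i|) (fun _ _ => abs_nonneg _)
        (Finset.mem_range.2 (not_le.1 hin))
    rw [div_le_iff₀ hε] at hK
    nlinarith

theorem abs_riemann_sum_sub_integral_le {g : ℝ → ℝ} {L : NNReal} (hg : LipschitzWith L g)
    {N : ℕ} (hN : 0 < N) :
    |(∑ i ∈ Finset.range N, g ((i : ℝ) / N)) / N - ∫ x in (0 : ℝ)..1, g x| ≤ L / N := by
  have hN' : (0 : ℝ) < N := by exact_mod_cast hN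
  have hsum := intervalIntegral.sum_integral_adjacent_intervals (f := g) (μ := volume)
    (a := fun k : ℕ => (k : ℝ) / N) (n := N) (fun k _ => hg.continuous.intervalIntegrable _ _)
  simp only [Nat.cast_zero, zero_div, div_self hN'.ne'] at hsum
  rw [← hsum, Finset.sum_div, ← Finset.sum_sub_distrib]
  refine (Finset.abs_sum_le_sum_abs _ _).trans ?_
  have hterm : ∀ i ∈ Finset.range N,
      |g ((i : ℝ) / N) / N - ∫ x in ((i : ℝ) / N)..(((i + 1 : ℕ) : ℝ) / N), g x| ≤ L / N * (1 / N) := by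
    intro i _
    have hlen : (((i + 1 : ℕ) : ℝ) / N) - (i : ℝ) / N = 1 / N := by push_cast; ring
    have hc : g ((i : ℝ) / N) / N = ∫ _ in ((i : ℝ) / N)..(((i + 1 : ℕ) : ℝ) / N), g ((i : ℝ) / N) := by
      rw [intervalIntegral.integral_const, hlen, smul_eq_mul]; ring
    rw [hc, ← intervalIntegral.integral_sub (by simp) (hg.continuous.intervalIntegrable _ _)]
    have := intervalIntegral.norm_integral_le_of_norm_le_const
      (a := (i : ℝ) / N) (b := ((i + 1 : ℕ) : ℝ) / N) (C := L / N)
      (f := fun x => g ((i : ℝ) / N) - g x) ?_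
    · rwa [Real.norm_eq_abs, hlen, abs_of_nonneg (by positivity : (0 : ℝ) ≤ 1 / N)] at this
    · intro x hx
      have hle : (i : ℝ) / N ≤ ((i + 1 : ℕ) : ℝ) / N := by gcongr; simp
      rw [uIoc_of_le hle] at hx
      have h1 := hg.dist_le_mul ((i : ℝ) / N) x
      rw [dist_eq_norm] at h1
      refine h1.trans ?_
      rw [div_eq_mul_one_div (L : ℝ)]
      refine mul_le_mul_of_nonneg_left ?_ L.coe_nonneg
      rw [dist_comm, Real.dist_eq, abs_of_nonneg (by linarith [hx.1])]
      linarith [hx.2]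
  refine (Finset.sum_le_sum hterm).trans ?_
  rw [Finset.sum_const, Finset.card_range, nsmul_eq_mul]
  apply le_of_eq
  field_simp

/-- Abel summation: only the partial sums of `e` matter. The boundary term costs `M * δ`, and at
most `N` increments of `g`, each at most `L / N`, cost `L * δ`. -/
theorem abs_sum_mul_le {g : ℝ → ℝ} {L : NNReal} (hg : LipschitzWith L g) {M δ : ℝ}
    (hM : ∀ x, |g x| ≤ M) {e : ℕ → ℝ} {N : ℕ} (hN : 0 < N)
    (he : ∀ i ≤ N, |∑ j ∈ Finset.range i, e j| ≤ δ) :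
    |∑ i ∈ Finset.range N, g ((i : ℝ) / N) * e i| ≤ (M + L) * δ := by
  have hN' : (0 : ℝ) < N := by exact_mod_cast hN
  have hδ : 0 ≤ δ := (abs_nonneg _).trans (he 0 (Nat.zero_le _))
  have := Finset.sum_range_by_parts (fun i : ℕ => g ((i : ℝ) / N)) e N
  simp only [smul_eq_mul] at this
  rw [this]
  refine (abs_sub _ _).trans ?_
  rw [add_mul]
  apply add_le_add
  · rw [abs_mul]
    exact mul_le_mul (hM _) (he N le_rfl) (abs_nonneg _) ((abs_nonneg _).trans (hM 0))
  · refine (Finset.abs_sum_le_sum_abs _ _).trans ?_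
    have hterm : ∀ i ∈ Finset.range (N - 1),
        |(g (((i + 1 : ℕ) : ℝ) / N) - g ((i : ℝ) / N)) * ∑ j ∈ Finset.range (i + 1), e j|
          ≤ L * (1 / N) * δ := by
      intro i hi
      rw [abs_mul]
      have hi' := Finset.mem_range.1 hi
      refine mul_le_mul ?_ (he _ (by omega)) (abs_nonneg _) (by positivity)
      have h1 := hg.dist_le_mul (((i + 1 : ℕ) : ℝ) / N) ((i : ℝ) / N)
      rw [Real.dist_eq, Real.dist_eq] at h1
      refine h1.trans (le_of_eq ?_)
      congr 1
      rw [← sub_div, Nat.cast_add, Nat.cast_one, add_sub_cancel_left]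
      exact abs_of_nonneg (by positivity)
    refine (Finset.sum_le_sum hterm).trans ?_
    rw [Finset.sum_const, Finset.card_range, nsmul_eq_mul]
    have : ((N - 1 : ℕ) : ℝ) ≤ N := by exact_mod_cast Nat.sub_le _ _
    calc ((N - 1 : ℕ) : ℝ) * (L * (1 / N) * δ) ≤ N * (L * (1 / N) * δ) := by gcongr
      _ = L * δ := by field_simp

theorem tendsto_error {c : ℕ → ℝ} {p : ℝ}
    (hc : Tendsto (fun n : ℕ => (∑ i ∈ Finset.range n, c i) / n) atTop (𝓝 p)) :
    Tendsto (fun n : ℕ => (∑ i ∈ Finset.range n, (c i - p)) / n) atTop (𝓝 0) := by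
  have := hc.sub_const p
  rw [sub_self] at this
  refine this.congr' ?_
  filter_upwards [eventually_gt_atTop 0] with n hn
  have hn' : (n : ℝ) ≠ 0 := by exact_mod_cast hn.ne'
  rw [Finset.sum_sub_distrib, Finset.sum_const, Finset.card_range, nsmul_eq_mul]
  field_simp

/-- Write `c i = p + (c i - p)`: the constant part is `p` times a Riemann sum, and the fluctuations
have partial sums that are uniformly `o(N)`, so Abel summation removes them. -/
theorem tendsto_weighted_riemann_sum {g : ℝ → ℝ} {L : NNReal} (hg : LipschitzWith L g) {M : ℝ}
    (hM : ∀ x, |g x| ≤ M) {c : ℕ → ℝ} {p : ℝ}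
    (hc : Tendsto (fun n : ℕ => (∑ i ∈ Finset.range n, c i) / n) atTop (𝓝 p)) :
    Tendsto (fun N : ℕ => (∑ i ∈ Finset.range N, g ((i : ℝ) / N) * c i) / N) atTop
      (𝓝 (p * ∫ x in (0 : ℝ)..1, g x)) := by
  have hM0 : 0 ≤ M := (abs_nonneg _).trans (hM 0)
  have h1 : Tendsto (fun N : ℕ => (∑ i ∈ Finset.range N, g ((i : ℝ) / N)) / N) atTop
      (𝓝 (∫ x in (0 : ℝ)..1, g x)) := by
    rw [tendsto_iff_norm_sub_tendsto_zero]
    refine squeeze_zero' (Eventually.of_forall fun _ => norm_nonneg _) ?_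
      (tendsto_const_div_atTop_nhds_zero_nat (L : ℝ))
    filter_upwards [eventually_gt_atTop 0] with N hN
    exact abs_riemann_sum_sub_integral_le hg hN
  have h2 : Tendsto (fun N : ℕ => (∑ i ∈ Finset.range N, g ((i : ℝ) / N) * (c i - p)) / N) atTop
      (𝓝 0) := by
    rw [Metric.tendsto_nhds]
    intro ε hε
    have hpos : 0 < M + L + 1 := by positivity
    filter_upwards [eventually_gt_atTop 0,
      eventually_forall_abs_le (tendsto_error hc) (ε := ε / (M + L + 1)) (by positivity)]
      with N hN hE
    have hN' : (0 : ℝ) < N := by exact_mod_cast hN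
    rw [Real.dist_eq, sub_zero, abs_div, Nat.abs_cast, div_lt_iff₀ hN']
    refine (abs_sum_mul_le hg hM hN hE).trans_lt ?_
    have : (M + L) * (ε / (M + L + 1) * N) = (M + L) / (M + L + 1) * (ε * N) := by ring
    rw [this]
    have h3 : (M + L) / (M + L + 1) < 1 := by rw [div_lt_one hpos]; linarith
    have h4 : 0 < ε * N := by positivity
    nlinarith
  have h3 := h2.add (h1.const_mul p)
  rw [zero_add] at h3
  refine h3.congr fun N => ?_
  rw [← mul_div_assoc, ← add_div, Finset.mul_sum, ← Finset.sum_add_distrib]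
  congr 1
  exact Finset.sum_congr rfl fun i _ => by ring

/-! ### The limiting law of (arrival time, type), with its two coordinates -/

/-- The law on `I × I` of `(u, t)` with `u` uniform and `t ∈ {0, 1}` an independent Bernoulli
variable of parameter `p`: the time of arrival of a vertex, and its type
(`1` dominating, `0` isolated). -/
noncomputable def arrivalLaw (p : I) : Measure (I × I) :=
  ENNReal.ofReal p • (volume : Measure I).map (fun u => (u, 1)) +
    ENNReal.ofReal (1 - p) • (volume : Measure I).map (fun u => (u, 0))

theorem continuous_prodMk_const (t : I) : Continuous (fun u : I => (u, t)) := by fun_prop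

instance isProbabilityMeasure_arrivalLaw (p : I) : IsProbabilityMeasure (arrivalLaw p) := by
  constructor
  simp only [arrivalLaw, Measure.add_apply, Measure.smul_apply, smul_eq_mul]
  rw [Measure.map_apply (continuous_prodMk_const 1).measurable MeasurableSet.univ,
    Measure.map_apply (continuous_prodMk_const 0).measurable MeasurableSet.univ]
  simp only [preimage_univ, measure_univ, mul_one]
  rw [← ENNReal.ofReal_add p.2.1 (by linarith [p.2.2])]
  simp

theorem arrivalLaw_apply (p : I) {s : Set (I × I)} (hs : MeasurableSet s) :
    arrivalLaw p s = ENNReal.ofReal p * volume {u : I | (u, (1 : I)) ∈ s} +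
      ENNReal.ofReal (1 - p) * volume {u : I | (u, (0 : I)) ∈ s} := by
  simp only [arrivalLaw, Measure.add_apply, Measure.smul_apply, smul_eq_mul]
  rw [Measure.map_apply (continuous_prodMk_const 1).measurable hs,
    Measure.map_apply (continuous_prodMk_const 0).measurable hs]
  rfl

theorem integral_arrivalLaw (p : I) {f : I × I → ℝ} (hf : Continuous f) :
    ∫ z, f z ∂(arrivalLaw p) = p * (∫ u : I, f (u, 1)) + (1 - p) * ∫ u : I, f (u, 0) := by
  have hint : ∀ t : I, Integrable f ((volume : Measure I).map (fun u => (u, t))) := fun t => by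
    rw [integrable_map_measure hf.aestronglyMeasurable (continuous_prodMk_const t).aemeasurable]
    exact (hf.comp (continuous_prodMk_const t)).integrable_of_hasCompactSupport
      (HasCompactSupport.of_compactSpace _)
  rw [arrivalLaw, integral_add_measure ((hint 1).smul_measure ENNReal.ofReal_ne_top)
    ((hint 0).smul_measure ENNReal.ofReal_ne_top), integral_smul_measure, integral_smul_measure,
    integral_map (continuous_prodMk_const 1).aemeasurable hf.aestronglyMeasurable,
    integral_map (continuous_prodMk_const 0).aemeasurable hf.aestronglyMeasurable,
    ENNReal.toReal_ofReal p.2.1, ENNReal.toReal_ofReal (by linarith [p.2.2])]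
  rfl

theorem integral_unitInterval (g : I → ℝ) :
    ∫ u : I, g u = ∫ x in (0 : ℝ)..1, IccExtend zero_le_one g x := by
  rw [intervalIntegral.integral_of_le zero_le_one, ← integral_Icc_eq_integral_Ioc,
    ← integral_subtype measurableSet_Icc]
  exact integral_congr_ae (Eventually.of_forall fun u => by simp)

/-- The limiting normalized degree of a vertex with arrival time `u` and type `t`. -/
noncomputable def limitDegree (p : I) (z : I × I) : I :=
  ⟨z.2 * z.1 + p * (1 - z.1), by
    obtain ⟨⟨u, hu⟩, ⟨t, ht⟩⟩ := z
    obtain ⟨p, hp⟩ := p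
    simp only
    constructor
    · have := mul_nonneg ht.1 hu.1
      have := mul_nonneg hp.1 (sub_nonneg.2 hu.2)
      linarith
    · have := mul_le_mul_of_nonneg_right ht.2 hu.1
      have := mul_le_mul_of_nonneg_right hp.2 (sub_nonneg.2 hu.2)
      linarith⟩

theorem continuous_limitDegree (p : I) : Continuous (limitDegree p) := by
  unfold limitDegree; fun_prop

/-- The uniform coordinate in `[0,1]` of a vertex with arrival time `u` and type `t`, increasing in
the limiting degree: the isolated vertices fill `[0,1-p]` and the dominating ones `[1-p,1]`. -/
noncomputable def rank (p : I) (z : I × I) : I :=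
  ⟨z.2 * (1 - p + p * z.1) + (1 - z.2) * ((1 - p) * (1 - z.1)), by
    obtain ⟨⟨u, hu⟩, ⟨t, ht⟩⟩ := z
    obtain ⟨p, hp⟩ := p
    simp only
    have h1 := mul_nonneg hp.1 hu.1
    have h2 := mul_le_mul_of_nonneg_left hu.2 hp.1
    have h3 := mul_nonneg (sub_nonneg.2 hp.2) (sub_nonneg.2 hu.2)
    have h4 := mul_nonneg (sub_nonneg.2 hp.2) hu.1
    have h5 := hp.1
    have h6 := hp.2
    have h7 : 0 ≤ 1 - p + p * u := by linarith
    have h8 : 1 - p + p * u ≤ 1 := by linarith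
    have h9 : (1 - p) * (1 - u) ≤ 1 := by linarith
    have ht1 := sub_nonneg.2 ht.2
    constructor
    · exact add_nonneg (mul_nonneg ht.1 h7) (mul_nonneg ht1 h3)
    · have := mul_le_mul_of_nonneg_left h8 ht.1
      have := mul_le_mul_of_nonneg_left h9 ht1
      linarith⟩

theorem continuous_rank (p : I) : Continuous (rank p) := by
  unfold rank; fun_prop

theorem rank_one (p u : I) : (rank p (u, 1) : ℝ) = 1 - p + p * u := by simp [rank]

theorem rank_zero (p u : I) : (rank p (u, 0) : ℝ) = (1 - p) * (1 - u) := by simp [rank]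

theorem limitDegree_one (p u : I) : (limitDegree p (u, 1) : ℝ) = u + p * (1 - u) := by
  simp [limitDegree]

theorem limitDegree_zero (p u : I) : (limitDegree p (u, 0) : ℝ) = p * (1 - u) := by
  simp [limitDegree]

theorem IccExtend_coe (f : I → ℝ) (u : I) : IccExtend zero_le_one f (u : ℝ) = f u := by simp

/-- Moves integrals over the subtype to interval integrals over `ℝ`, where affine changes of
variable are available. -/
theorem integral_comp_of_coe_eq {h : I → I} {k : ℝ → ℝ} (hk : ∀ u : I, (h u : ℝ) = k u)
    (f : I → ℝ) : ∫ u : I, f (h u) = ∫ x in (0 : ℝ)..1, IccExtend zero_le_one f (k x) := by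
  rw [intervalIntegral.integral_of_le zero_le_one, ← integral_Icc_eq_integral_Ioc,
    ← integral_subtype measurableSet_Icc]
  refine integral_congr_ae (Eventually.of_forall fun u => ?_)
  have : IccExtend zero_le_one f (k u) = f (h u) := by rw [← hk, IccExtend_coe]
  exact this.symm

/-- Each type is mapped affinely onto its own subinterval, of length `p` or `1 - p`; this scale
factor is exactly the mass of the type. The scaled substitution formulas need no division, so `p =
0` and `p = 1` are covered. -/
theorem measurePreserving_rank (p : I) : MeasurePreserving (rank p) (arrivalLaw p) volume := by
  refine ⟨(continuous_rank p).measurable, ?_⟩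
  have := Measure.isProbabilityMeasure_map (μ := arrivalLaw p) (continuous_rank p).aemeasurable
  refine ext_of_forall_integral_eq_of_IsFiniteMeasure fun f => ?_
  have hF : Continuous (IccExtend zero_le_one (f : I → ℝ)) := f.continuous.Icc_extend'
  rw [integral_map (continuous_rank p).aemeasurable f.continuous.aestronglyMeasurable,
    integral_arrivalLaw p (f := fun z => f (rank p z)) (f.continuous.comp (continuous_rank p)),
    integral_comp_of_coe_eq (k := fun x => 1 - p + p * x) (rank_one p),
    integral_comp_of_coe_eq (k := fun x => (1 - p) - (1 - p) * x)
      (fun u => by rw [rank_zero]; ring),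
    intervalIntegral.mul_integral_comp_add_mul, intervalIntegral.mul_integral_comp_sub_mul,
    integral_unitInterval, add_comm]
  simp only [mul_zero, mul_one, sub_zero, add_zero, sub_self, sub_add_cancel]
  exact intervalIntegral.integral_add_adjacent_intervals (hF.intervalIntegrable _ _)
    (hF.intervalIntegrable _ _)

/-- `arrivalLaw p` as a `ProbabilityMeasure`. -/
noncomputable def arrivalProb (p : I) : ProbabilityMeasure (I × I) := ⟨arrivalLaw p, inferInstance⟩

/-- The limiting degree distribution `μ_p`. -/
noncomputable def limitMeasure (p : I) : ProbabilityMeasure I :=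
  (arrivalProb p).map (continuous_limitDegree p).aemeasurable

theorem coe_limitMeasure (p : I) :
    (limitMeasure p : Measure I) = (arrivalLaw p).map (limitDegree p) := rfl

theorem integral_limitMeasure (p : I) {f : I → ℝ} (hf : Continuous f) :
    ∫ x, f x ∂(limitMeasure p : Measure I) =
      p * (∫ u : I, f (limitDegree p (u, 1))) + (1 - p) * ∫ u : I, f (limitDegree p (u, 0)) := by
  rw [coe_limitMeasure, integral_map (continuous_limitDegree p).aemeasurable
    hf.aestronglyMeasurable]
  exact integral_arrivalLaw p (hf.comp (continuous_limitDegree p))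

theorem limitMeasure_zero : (limitMeasure 0 : Measure I) = Measure.dirac 0 := by
  refine ext_of_forall_integral_eq_of_IsFiniteMeasure fun f => ?_
  rw [integral_limitMeasure 0 f.continuous, integral_dirac]
  have h : ∀ u : I, limitDegree 0 (u, 0) = 0 := fun u => by
    apply Subtype.ext; rw [limitDegree_zero]; simp
  simp [h]

theorem limitMeasure_one : (limitMeasure 1 : Measure I) = Measure.dirac 1 := by
  refine ext_of_forall_integral_eq_of_IsFiniteMeasure fun f => ?_
  rw [integral_limitMeasure 1 f.continuous, integral_dirac]
  have h : ∀ u : I, limitDegree 1 (u, 1) = 1 := fun u => by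
    apply Subtype.ext; rw [limitDegree_one]; simp
  simp [h]

/-- The density of `μ_p` for `0 < p < 1`. -/
theorem limitMeasure_eq_withDensity {p : I} (h0 : 0 < (p : ℝ)) (h1 : (p : ℝ) < 1) :
    (limitMeasure p : Measure I) = (volume : Measure I).withDensity
      (fun x => ENNReal.ofReal (if (x : ℝ) < p then (1 - p) / p else p / (1 - p))) := by
  have h1' : (0 : ℝ) < 1 - p := by linarith
  set d : ℝ → ℝ := fun x => if x < p then (1 - p) / p else p / (1 - p) with hd
  have hd0 : ∀ x, 0 ≤ d x := fun x => by
    simp only [hd]; split_ifs <;> positivity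
  have hdm : Measurable d := Measurable.ite measurableSet_Iio measurable_const measurable_const
  have hdb : ∀ x, d x ≤ (1 - p) / p + p / (1 - p) := fun x => by
    have : 0 ≤ (1 - (p : ℝ)) / p := by positivity
    have : 0 ≤ (p : ℝ) / (1 - p) := by positivity
    simp only [hd]; split_ifs <;> linarith
  have hdI : Measurable fun x : I => ENNReal.ofReal (d x) :=
    ENNReal.measurable_ofReal.comp (hdm.comp measurable_subtype_coe)
  change _ = (volume : Measure I).withDensity (fun x => ENNReal.ofReal (d x))
  have hfin : IsFiniteMeasure ((volume : Measure I).withDensity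
      (fun x => ENNReal.ofReal (d x))) := by
    refine isFiniteMeasure_withDensity ?_
    refine ne_of_lt (lt_of_le_of_lt (lintegral_mono fun x => ENNReal.ofReal_le_ofReal (hdb x)) ?_)
    simp
  refine ext_of_forall_integral_eq_of_IsFiniteMeasure fun f => ?_
  set F := IccExtend zero_le_one (f : I → ℝ) with hFdef
  have hF : Continuous F := f.continuous.Icc_extend'
  rw [integral_limitMeasure p f.continuous,
    integral_comp_of_coe_eq (h := fun u => limitDegree p (u, 1)) (k := fun x => p + (1 - p) * x)
      (fun u => by rw [limitDegree_one]; ring),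
    integral_comp_of_coe_eq (h := fun u => limitDegree p (u, 0)) (k := fun x => p - p * x)
      (fun u => by rw [limitDegree_zero]; ring)]
  rw [integral_withDensity_eq_integral_toReal_smul hdI (by simp)]
  simp only [ENNReal.toReal_ofReal (hd0 _), smul_eq_mul]
  have hR : ∫ x : I, d x * f x = ∫ x in (0 : ℝ)..1, d x * F x := by
    rw [intervalIntegral.integral_of_le zero_le_one, ← integral_Icc_eq_integral_Ioc,
      ← integral_subtype measurableSet_Icc]
    exact integral_congr_ae (Eventually.of_forall fun u => by simp [F])
  -- The open interval is needed because at the point `p` itself the density takes its right-hand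
  -- value.
  have hl : ∫ x in (0 : ℝ)..p, d x * F x = (1 - p) / p * ∫ x in (0 : ℝ)..p, F x := by
    rw [← intervalIntegral.integral_const_mul, intervalIntegral.integral_of_le h0.le,
      intervalIntegral.integral_of_le h0.le, integral_Ioc_eq_integral_Ioo,
      integral_Ioc_eq_integral_Ioo]
    refine setIntegral_congr_fun measurableSet_Ioo fun x hx => ?_
    simp only [hd, if_pos hx.2]
  have hr : ∫ x in (p : ℝ)..1, d x * F x = p / (1 - p) * ∫ x in (p : ℝ)..1, F x := by
    rw [← intervalIntegral.integral_const_mul]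
    refine intervalIntegral.integral_congr fun x hx => ?_
    rw [uIcc_of_le h1.le] at hx
    simp only [hd, if_neg (not_lt.2 hx.1)]
  have hint : ∀ a b : ℝ, IntervalIntegrable (fun x => d x * F x) volume a b := fun a b => by
    have h2 : IntervalIntegrable d volume a b := by
      rw [intervalIntegrable_iff]
      refine Measure.integrableOn_of_bounded (M := (1 - p) / p + p / (1 - p)) (by simp)
        hdm.aestronglyMeasurable (Eventually.of_forall fun x => ?_)
      rw [Real.norm_eq_abs, abs_of_nonneg (hd0 x)]
      exact hdb x
    exact h2.mul_continuousOn hF.continuousOn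
  rw [hR, ← intervalIntegral.integral_add_adjacent_intervals (hint 0 p) (hint p 1), hl, hr]
  -- Dominating degrees `p + (1 - p) * x` sweep `[p, 1]`, isolated degrees `p - p * x` sweep `[0,
  -- p]`; each density is mass over length.
  have e1 := intervalIntegral.mul_integral_comp_add_mul (a := 0) (b := 1) (f := F) (1 - p) p
  have e2 := intervalIntegral.mul_integral_comp_sub_mul (a := 0) (b := 1) (f := F) p p
  simp only [mul_zero, mul_one, sub_zero, add_zero, sub_self, add_sub_cancel] at e1 e2
  rw [← e1, ← e2]
  field_simp
  ring

theorem limitMeasure_half {p : I} (h : (p : ℝ) = 1 / 2) :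
    (limitMeasure p : Measure I) = volume := by
  rw [limitMeasure_eq_withDensity (by rw [h]; norm_num) (by rw [h]; norm_num)]
  rw [h]
  norm_num

/-! ### Adjacency in the sequentially built graph -/

theorem addVertex_adj_castSucc {n : ℕ} (G : SimpleGraph (Fin n)) (b : Bool) (i j : Fin n) :
    (addVertex G b).Adj i.castSucc j.castSucc ↔ G.Adj i j := by
  have hne : ∀ k : Fin n, k.castSucc ≠ Fin.last n := fun k => (Fin.castSucc_lt_last k).ne
  have hex : ∀ k l : Fin n, (∃ i' j' : Fin n, k.castSucc = i'.castSucc ∧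
      l.castSucc = j'.castSucc ∧ G.Adj i' j') ↔ G.Adj k l := fun k l =>
    ⟨fun ⟨i', j', h1, h2, h⟩ => by
      rwa [Fin.castSucc_injective n h1, Fin.castSucc_injective n h2],
      fun h => ⟨k, l, rfl, rfl, h⟩⟩
  rw [addVertex, SimpleGraph.fromRel_adj, hex, hex]
  simp only [hne, false_and, or_false]
  constructor
  · rintro ⟨-, h | h⟩
    exacts [h, h.symm]
  · exact fun h => ⟨fun e => h.ne (Fin.castSucc_injective n e), Or.inl h⟩

theorem addVertex_adj_last {n : ℕ} (G : SimpleGraph (Fin n)) (b : Bool) (i : Fin n) :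
    (addVertex G b).Adj i.castSucc (Fin.last n) ↔ b = true := by
  have hne : ∀ k : Fin n, k.castSucc ≠ Fin.last n := fun k => (Fin.castSucc_lt_last k).ne
  rw [addVertex, SimpleGraph.fromRel_adj]
  simp only [(hne _).symm, hne, false_and, and_false, exists_false, or_false, false_or, ne_eq,
    not_false_eq_true, true_and]

/-- Vertex `j ≥ 1` is addition number `j - 1`, and the later vertex of a pair decides. The truncated
value `0 - 1 = 0` at vertex `0` plays no role, as that vertex is never the later one. -/
theorem seqGraph_adj (dom : ℕ → Bool) (n : ℕ) (i j : Fin (n + 1)) :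
    (seqGraph dom n).Adj i j ↔
      (i < j ∧ dom (j - 1) = true) ∨ (j < i ∧ dom (i - 1) = true) := by
  induction n with
  | zero =>
    obtain rfl : i = j := Fin.ext (by omega)
    simp
  | succ n ih =>
    rw [seqGraph]
    induction i using Fin.lastCases with
    | last =>
      induction j using Fin.lastCases with
      | last => simp
      | cast j =>
        rw [SimpleGraph.adj_comm, addVertex_adj_last]
        simp [Fin.castSucc_lt_last, (Fin.castSucc_lt_last j).not_gt]
    | cast i =>
      induction j using Fin.lastCases with
      | last =>
        rw [addVertex_adj_last]
        simp [Fin.castSucc_lt_last, (Fin.castSucc_lt_last i).not_gt]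
      | cast j =>
        rw [addVertex_adj_castSucc, ih]
        simp

/-- The sign of a weight records the type, and its absolute value grows with arrival, so the later
vertex fixes the sign of the sum. -/
theorem isThreshold_seqGraph (dom : ℕ → Bool) (n : ℕ) : IsThreshold (seqGraph dom n) := by
  obtain ⟨w, hw⟩ : ∃ w : Fin (n + 1) → ℝ, ∀ i : Fin (n + 1), w i =
      if dom (i - 1) = true then ((i : ℕ) + 1 : ℝ) else -((i : ℕ) + 1 : ℝ) := ⟨_, fun _ => rfl⟩
  have key : ∀ a b : Fin (n + 1), a < b → (0 < w a + w b ↔ dom (b - 1) = true) := fun a b hab => by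
    have hab' : ((a : ℕ) : ℝ) < (b : ℕ) := by exact_mod_cast hab
    have ha0 : (0 : ℝ) ≤ (a : ℕ) := by positivity
    rw [hw a, hw b]
    by_cases hb : dom (b - 1) = true
    · simp only [hb, if_true, iff_true]
      split_ifs <;> linarith
    · rw [if_neg hb]
      refine iff_of_false (not_lt.2 ?_) hb
      split_ifs <;> linarith
  refine ⟨w, 0, fun i j hij => ?_⟩
  rw [seqGraph_adj]
  rcases lt_or_gt_of_ne hij with h | h
  · rw [key i j h]; simp [h, h.not_gt]
  · rw [add_comm (w i), key j i h]; simp [h, h.not_gt]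

/-! ### Arrival points -/

/-- The arrival time and type of vertex `i` of the sequentially built graph, rescaled to `I`. -/
noncomputable def arrivalPoint (dom : ℕ → Bool) (n : ℕ) (i : Fin (n + 1)) : I × I :=
  (⟨((i : ℕ) : ℝ) / ((n + 1 : ℕ) : ℝ), by
    constructor
    · positivity
    · exact div_le_one_of_le₀ (by exact_mod_cast i.2.le) (by positivity)⟩,
    if dom (i - 1) = true then 1 else 0)

/-- Adjacency in terms of arrival times and types. -/
def arrivalRel (z w : I × I) : Prop :=
  (z.1 < w.1 ∧ (1 / 2 : ℝ) < w.2) ∨ (w.1 < z.1 ∧ (1 / 2 : ℝ) < z.2)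

theorem seqGraph_adj_iff_arrivalRel (dom : ℕ → Bool) (n : ℕ) (i j : Fin (n + 1)) :
    (seqGraph dom n).Adj i j ↔ arrivalRel (arrivalPoint dom n i) (arrivalPoint dom n j) := by
  have hlt : ∀ k l : Fin (n + 1), (arrivalPoint dom n k).1 < (arrivalPoint dom n l).1 ↔ k < l :=
    fun k l => by
      rw [← Subtype.coe_lt_coe]
      simp only [arrivalPoint]
      rw [div_lt_div_iff_of_pos_right (by positivity)]
      exact Nat.cast_lt
  have ht : ∀ k : Fin (n + 1), (1 / 2 : ℝ) < (arrivalPoint dom n k).2 ↔ dom (k - 1) = true :=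
    fun k => by
      simp only [arrivalPoint]
      split_ifs with h <;> simp [h]
      norm_num
  rw [seqGraph_adj, arrivalRel, hlt, hlt, ht, ht]

/-! ### Empirical measures -/

/-- The uniform distribution on a finite family of points. -/
noncomputable def empirical {ι α : Type*} [Fintype ι] [Nonempty ι] [MeasurableSpace α]
    (f : ι → α) : ProbabilityMeasure α :=
  ⟨(Fintype.card ι : ENNReal)⁻¹ • ∑ i : ι, Measure.dirac (f i), ⟨by
    simp [ENNReal.inv_mul_cancel]⟩⟩

theorem coe_empirical {ι α : Type*} [Fintype ι] [Nonempty ι] [MeasurableSpace α] (f : ι → α) :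
    (empirical f : Measure α) = (Fintype.card ι : ENNReal)⁻¹ • ∑ i : ι, Measure.dirac (f i) := rfl

theorem degreeDist_eq_empirical {V : Type*} [Fintype V] [Nonempty V] (G : SimpleGraph V) :
    degreeDist G = empirical (normDegree G) := rfl

theorem integral_empirical {ι α : Type*} [Fintype ι] [Nonempty ι] [MeasurableSpace α] (f : ι → α)
    {g : α → ℝ} (hg : Measurable g) :
    ∫ x, g x ∂(empirical f : Measure α) = (∑ i, g (f i)) / Fintype.card ι := by
  have hm : ∀ i ∈ Finset.univ, Integrable g (Measure.dirac (f i)) := fun i _ =>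
    integrable_dirac' hg.stronglyMeasurable (by simp)
  rw [coe_empirical, integral_smul_measure, integral_finsetSum_measure hm]
  simp only [integral_dirac' g _ hg.stronglyMeasurable, ENNReal.toReal_inv, ENNReal.toReal_natCast,
    smul_eq_mul]
  rw [inv_mul_eq_div]

theorem map_empirical {ι α β : Type*} [Fintype ι] [Nonempty ι] [MeasurableSpace α]
    [MeasurableSpace β] (f : ι → α) {g : α → β} (hg : Measurable g) :
    (empirical f : Measure α).map g = empirical (g ∘ f) := by
  rw [coe_empirical, coe_empirical, Measure.map_smul, ← Measure.mapₗ_apply_of_measurable hg,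
    map_sum]
  simp only [Measure.mapₗ_apply_of_measurable hg, Measure.map_dirac' hg, Function.comp]

/-- Independent samples from an empirical law amount to a uniformly random map `κ → ι`; this is what
turns homomorphism densities into product measures. -/
theorem pi_empirical_real {ι κ α : Type*} [Fintype ι] [Nonempty ι] [Fintype κ] [MeasurableSpace α]
    (f : ι → α) {A : Set (κ → α)} (hA : MeasurableSet A) :
    (Measure.pi fun _ : κ => (empirical f : Measure α)).real A =
      (Nat.card {x : κ → ι // (fun i => f (x i)) ∈ A} : ℝ) /
        (Fintype.card ι : ℝ) ^ Fintype.card κ := by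
  classical
  -- Counting is done on `ι` with its discrete σ-algebra and pushed forward, so `f` need not be
  -- injective.
  let _ : MeasurableSpace ι := ⊤
  have hf : Measurable f := measurable_from_top
  have h1 : (empirical f : Measure α) = (empirical (id : ι → ι) : Measure ι).map f := by
    rw [map_empirical _ hf]; rfl
  have h2 : (Measure.pi fun _ : κ => (empirical f : Measure α)) =
      (Measure.pi fun _ : κ => (empirical (id : ι → ι) : Measure ι)).map
        (fun x i => f (x i)) := by
    have := Measure.isProbabilityMeasure_map (μ := (empirical (id : ι → ι) : Measure ι))
      hf.aemeasurable
    rw [Measure.pi_map_pi (fun _ => hf.aemeasurable), h1]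
  have hmeas : Measurable fun (x : κ → ι) i => f (x i) :=
    measurable_pi_lambda _ fun i => hf.comp (measurable_pi_apply i)
  rw [h2, map_measureReal_apply hmeas hA]
  set S : Set (κ → ι) := (fun x i => f (x i)) ⁻¹' A
  have hsing : ∀ x : κ → ι,
      (Measure.pi fun _ : κ => (empirical (id : ι → ι) : Measure ι)).real {x} =
        ((Fintype.card ι : ℝ) ^ Fintype.card κ)⁻¹ := fun x => by
    rw [measureReal_def, Measure.pi_singleton]
    have : ∀ i : ι, (empirical (id : ι → ι) : Measure ι) {i} = (Fintype.card ι : ENNReal)⁻¹ := by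
      intro i
      rw [coe_empirical]
      simp [Set.indicator]
    simp [this]
  have hfin : S = ((Finset.univ.filter (· ∈ S) : Finset (κ → ι)) : Set (κ → ι)) := by simp
  have hcard : Nat.card {x : κ → ι // (fun i => f (x i)) ∈ A} =
      (Finset.univ.filter (· ∈ S)).card := by
    rw [Nat.card_eq_fintype_card, Fintype.card_subtype]; rfl
  rw [hcard, hfin, ← sum_measureReal_singleton]
  simp [hsing, div_eq_mul_inv]

/-! ### Convergence of the empirical law of the arrival points -/

/-- The type of vertex `i` of the sequentially built graph: `1` if dominating, `0` if isolated. -/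
def vertexType (dom : ℕ → Bool) (i : ℕ) : ℝ := if dom (i - 1) = true then 1 else 0

/-- The types are the additions shifted by one, preceded by vertex `0` with the default value `dom
0`; one bounded term does not affect the average. -/
theorem tendsto_average_vertexType {dom : ℕ → Bool} {p : ℝ}
    (h : Tendsto (fun n : ℕ => (∑ k ∈ Finset.range n, if dom k = true then (1 : ℝ) else 0) / n)
      atTop (𝓝 p)) :
    Tendsto (fun n : ℕ => (∑ i ∈ Finset.range n, vertexType dom i) / n) atTop (𝓝 p) := by
  rw [← tendsto_add_atTop_iff_nat 1]
  have h1 := tendsto_const_div_atTop_nhds_zero_nat (vertexType dom 0)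
  have h2 := (h1.add h).mul (tendsto_natCast_div_add_atTop (1 : ℝ))
  rw [zero_add, mul_one] at h2
  refine h2.congr' ?_
  filter_upwards [eventually_gt_atTop 0] with n hn
  have hn' : (n : ℝ) ≠ 0 := by exact_mod_cast hn.ne'
  rw [Finset.sum_range_succ', add_comm (∑ _ ∈ _, _)]
  have : ∀ k, vertexType dom (k + 1) = if dom k = true then (1 : ℝ) else 0 := fun k => rfl
  simp only [this]
  push_cast
  field_simp

/-- Against a Lipschitz `f`, the empirical integral is the sum of two weighted Riemann sums: `f (·,
1)` weighted by the types and `f (·, 0)` by their complements. -/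
theorem tendsto_empirical_arrivalPoint {dom : ℕ → Bool} {p : I}
    (h : Tendsto (fun n : ℕ => (∑ i ∈ Finset.range n, vertexType dom i) / n) atTop (𝓝 (p : ℝ))) :
    Tendsto (fun n : ℕ => empirical (arrivalPoint dom n)) atTop
      (𝓝 (arrivalProb p)) := by
  rw [tendsto_iff_forall_lipschitz_integral_tendsto]
  rintro f - ⟨L, hL⟩
  obtain ⟨M, hM⟩ : ∃ M, ∀ z, |f z| ≤ M := by
    obtain ⟨M, hM⟩ := isCompact_univ.exists_bound_of_continuousOn hL.continuous.continuousOn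
    exact ⟨M, fun z => hM z (mem_univ z)⟩
  set F : I → ℝ → ℝ := fun t => IccExtend zero_le_one fun u => f (u, t) with hF
  have hFL : ∀ t, LipschitzWith (L * 1 * 1) (F t) := fun t =>
    (hL.comp (LipschitzWith.prodMk_right t)).comp (LipschitzWith.projIcc _)
  have hFM : ∀ t x, |F t x| ≤ M := fun t x => hM _
  have h' : Tendsto (fun n : ℕ => (∑ i ∈ Finset.range n, (1 - vertexType dom i)) / n) atTop
      (𝓝 (1 - p : ℝ)) := by
    refine (h.const_sub 1).congr' ?_
    filter_upwards [eventually_gt_atTop 0] with n hn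
    have hn' : (n : ℝ) ≠ 0 := by exact_mod_cast hn.ne'
    rw [Finset.sum_sub_distrib, Finset.sum_const, Finset.card_range, nsmul_eq_mul]
    field_simp
  have key := (tendsto_weighted_riemann_sum (hFL 1) (hFM 1) h).add
    (tendsto_weighted_riemann_sum (hFL 0) (hFM 0) h')
  have hlim : ∫ z, f z ∂(arrivalLaw p) =
      p * (∫ x in (0 : ℝ)..1, F 1 x) + (1 - p) * ∫ x in (0 : ℝ)..1, F 0 x := by
    rw [integral_arrivalLaw p hL.continuous, integral_unitInterval, integral_unitInterval]
  change Tendsto _ _ (𝓝 (∫ z, f z ∂(arrivalLaw p)))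
  rw [hlim]
  refine ((tendsto_add_atTop_iff_nat 1).2 key).congr fun n => ?_
  rw [integral_empirical _ hL.continuous.measurable, Fintype.card_fin, ← add_div,
    ← Finset.sum_add_distrib, Finset.sum_range]
  congr 1
  refine Finset.sum_congr rfl fun i _ => ?_
  have hval : ∀ t : I, F t (((i : ℕ) : ℝ) / ((n + 1 : ℕ) : ℝ)) = f ((arrivalPoint dom n i).1, t) :=
    fun t => IccExtend_coe (fun u => f (u, t)) (arrivalPoint dom n i).1
  rw [hval, hval]
  by_cases hd : dom ((i : ℕ) - 1) = true <;> simp [arrivalPoint, vertexType, hd]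

/-! ### Convergence of the degree distribution -/

/-- The first term counts earlier neighbours, all or none according to the vertex's own type; the
difference counts the later dominating vertices. -/
theorem degree_seqGraph (dom : ℕ → Bool) (n : ℕ) (i : Fin (n + 1))
    [DecidableRel (seqGraph dom n).Adj] :
    ((seqGraph dom n).degree i : ℝ) = vertexType dom i * (i : ℕ) +
      (∑ j ∈ Finset.range (n + 1), vertexType dom j -
        ∑ j ∈ Finset.range ((i : ℕ) + 1), vertexType dom j) := by
  have h1 : ((seqGraph dom n).degree i : ℝ) = ∑ j ∈ Finset.range (n + 1),
      ((if j < (i : ℕ) then vertexType dom i else 0) +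
        if (i : ℕ) < j then vertexType dom j else 0) := by
    rw [← SimpleGraph.card_neighborFinset_eq_degree, SimpleGraph.neighborFinset_eq_filter,
      Finset.card_filter, Nat.cast_sum, Finset.sum_range]
    refine Finset.sum_congr rfl fun j _ => ?_
    have hadj := seqGraph_adj dom n i j
    rcases lt_trichotomy i j with hij | hij | hij
    · have hij' : (i : ℕ) < j := hij
      by_cases hd : dom ((j : ℕ) - 1) = true <;>
        simp [hadj, hij, hij.not_gt, hij', hij'.not_gt, vertexType, hd]
    · subst hij; simp
    · have hij' : (j : ℕ) < i := hij
      by_cases hd : dom ((i : ℕ) - 1) = true <;>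
        simp [hadj, hij, hij.not_gt, hij', hij'.not_gt, vertexType, hd]
  have hi : (i : ℕ) + 1 ≤ n + 1 := i.2
  rw [h1, ← Finset.sum_range_add_sum_Ico _ hi, ← Finset.sum_range_add_sum_Ico
    (fun j => vertexType dom j) hi, add_sub_cancel_left]
  congr 1
  · rw [Finset.sum_range_succ, Finset.sum_congr rfl (g := fun _ => vertexType dom i)
      (fun j hj => by
        have := Finset.mem_range.1 hj
        simp [this, this.not_gt])]
    simp [mul_comm]
  · refine Finset.sum_congr rfl fun j hj => ?_
    have : (i : ℕ) < j := (Finset.mem_Ico.1 hj).1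
    simp [this, this.not_gt]

theorem abs_normDegree_sub_le {dom : ℕ → Bool} {p : I} {n : ℕ} {δ : ℝ}
    (hE : ∀ i ≤ n + 1, |∑ j ∈ Finset.range i, (vertexType dom j - p)| ≤ δ * (n + 1 : ℕ))
    (i : Fin (n + 1)) :
    |(normDegree (seqGraph dom n) i : ℝ) - limitDegree p (arrivalPoint dom n i)|
      ≤ 2 * δ + 1 / ((n + 1 : ℕ) : ℝ) := by
  have hN : (0 : ℝ) < ((n + 1 : ℕ) : ℝ) := by positivity
  have hsum : ∀ m : ℕ, ∑ j ∈ Finset.range m, vertexType dom j =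
      ∑ j ∈ Finset.range m, (vertexType dom j - p) + p * m := fun m => by
    rw [Finset.sum_sub_distrib, Finset.sum_const, Finset.card_range, nsmul_eq_mul]; ring
  have h1 := abs_le.1 (hE (n + 1) le_rfl)
  have h2 := abs_le.1 (hE (i + 1) i.2)
  have hp := p.2
  have ht : ((arrivalPoint dom n i).2 : ℝ) = vertexType dom i := by
    simp only [arrivalPoint, vertexType]; split_ifs <;> rfl
  -- The extra `- p` arises because a vertex is not counted among those after it: `N - i - 1`
  -- vertices come later, against `N - i` in the limiting formula.
  have hdiff : (normDegree (seqGraph dom n) i : ℝ) - limitDegree p (arrivalPoint dom n i) =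
      (∑ j ∈ Finset.range (n + 1), (vertexType dom j - p) -
        ∑ j ∈ Finset.range ((i : ℕ) + 1), (vertexType dom j - p) - p) / ((n + 1 : ℕ) : ℝ) := by
    simp only [normDegree, limitDegree]
    rw [degree_seqGraph, ht, hsum (n + 1), hsum (i + 1), Fintype.card_fin]
    simp only [arrivalPoint]
    rw [eq_div_iff hN.ne', sub_mul, div_mul_cancel₀ _ hN.ne', add_mul, mul_assoc (p : ℝ), sub_mul,
      mul_assoc (vertexType dom i), div_mul_cancel₀ _ hN.ne']
    push_cast
    ring
  rw [hdiff, abs_div, abs_of_pos hN, div_le_iff₀ hN, add_mul, one_div, inv_mul_cancel₀ hN.ne']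
  rw [abs_le]
  constructor <;> linarith [hp.1, hp.2, h1.1, h1.2, h2.1, h2.2]

/-- The image of the empirical arrival law under `limitDegree` converges by continuity; the true
degrees are uniformly close to it, hence have the same limit against Lipschitz functions. -/
theorem tendsto_degreeDist_seqGraph {dom : ℕ → Bool} {p : I}
    (h : Tendsto (fun n : ℕ => (∑ i ∈ Finset.range n, vertexType dom i) / n) atTop (𝓝 (p : ℝ))) :
    Tendsto (fun n : ℕ => degreeDist (seqGraph dom n)) atTop (𝓝 (limitMeasure p)) := by
  have hmap := ProbabilityMeasure.tendsto_map_of_tendsto_of_continuous _ _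
    (tendsto_empirical_arrivalPoint h) (continuous_limitDegree p)
  rw [tendsto_iff_forall_lipschitz_integral_tendsto] at hmap ⊢
  rintro f hfb ⟨L, hL⟩
  have h1 := hmap f hfb ⟨L, hL⟩
  have hsmall : Tendsto (fun n : ℕ => ∫ x, f x ∂(degreeDist (seqGraph dom n) : Measure I) -
      ∫ x, f x ∂((empirical (arrivalPoint dom n)).map
        (continuous_limitDegree p).aemeasurable : Measure I)) atTop (𝓝 0) := by
    rw [Metric.tendsto_nhds]
    intro ε hε
    -- Degrees differ by at most `2 * δ + 1 / N < 3 * δ`, and `3 * L * δ < 4 * (L + 1) * δ = ε`.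
    set δ : ℝ := ε / (4 * (L + 1)) with hδ
    have hδ0 : 0 < δ := by positivity
    have hev := (eventually_forall_abs_le (tendsto_error h) hδ0)
    have hinv := (tendsto_one_div_atTop_nhds_zero_nat (𝕜 := ℝ)).eventually (gt_mem_nhds hδ0)
    filter_upwards [(tendsto_add_atTop_nat 1).eventually hev,
      (tendsto_add_atTop_nat 1).eventually hinv] with n hE hn
    have hN : (0 : ℝ) < ((n + 1 : ℕ) : ℝ) := by positivity
    rw [Real.dist_eq, sub_zero, degreeDist_eq_empirical,
      integral_empirical _ hL.continuous.measurable, ProbabilityMeasure.toMeasure_map,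
      map_empirical _ (continuous_limitDegree p).measurable,
      integral_empirical _ hL.continuous.measurable, ← sub_div, ← Finset.sum_sub_distrib,
      Fintype.card_fin, abs_div, abs_of_pos hN, div_lt_iff₀ hN]
    have hterm : ∀ i ∈ Finset.univ, |f (normDegree (seqGraph dom n) i) -
        f ((limitDegree p ∘ arrivalPoint dom n) i)| ≤ L * (3 * δ) := fun i _ => by
      have hd := hL.dist_le_mul (normDegree (seqGraph dom n) i)
        (limitDegree p (arrivalPoint dom n i))
      rw [Real.dist_eq, Subtype.dist_eq, Real.dist_eq] at hd
      refine hd.trans (mul_le_mul_of_nonneg_left ?_ L.coe_nonneg)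
      have := abs_normDegree_sub_le hE i
      linarith
    refine ((Finset.abs_sum_le_sum_abs _ _).trans (Finset.sum_le_sum hterm)).trans_lt ?_
    rw [Finset.sum_const, Finset.card_univ, Fintype.card_fin, nsmul_eq_mul, mul_comm]
    refine mul_lt_mul_of_pos_right ?_ hN
    have hL0 := L.coe_nonneg
    have : ε = 4 * (L + 1) * δ := by rw [hδ]; field_simp
    rw [this]
    nlinarith [mul_nonneg hL0 hδ0.le]
  have := hsmall.add h1
  rw [zero_add] at this
  exact this.congr fun n => by rw [sub_add_cancel]

/-! ### The set `S_μ` of the limiting degree distribution -/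

theorem leftCDF_limitMeasure (p x : I) :
    leftCDF (limitMeasure p) x =
      p * (volume : Measure I).real {u | limitDegree p (u, 1) < x} +
        (1 - p) * (volume : Measure I).real {u | limitDegree p (u, 0) < x} := by
  have hp1 : (0 : ℝ) ≤ 1 - p := by linarith [p.2.2]
  rw [leftCDF, coe_limitMeasure, map_measureReal_apply (continuous_limitDegree p).measurable
    measurableSet_Iio, measureReal_def,
    arrivalLaw_apply p ((continuous_limitDegree p).measurable measurableSet_Iio),
    ENNReal.toReal_add (by finiteness) (by finiteness), ENNReal.toReal_mul, ENNReal.toReal_mul,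
    ENNReal.toReal_ofReal p.2.1, ENNReal.toReal_ofReal hp1]
  rfl

/-- One minus the rank is `p * (1 - v)`, the limiting degree of an isolated vertex arriving at `v`.
Only isolated vertices arriving after `v` have smaller degree. -/
theorem leftCDF_symm_rank_one {p : I} (h0 : 0 < (p : ℝ)) (v : I) :
    leftCDF (limitMeasure p) (unitInterval.symm (rank p (v, 1))) = (1 - p) * (1 - v) := by
  have hx : (unitInterval.symm (rank p (v, 1)) : ℝ) = p * (1 - v) := by
    rw [unitInterval.coe_symm_eq, rank_one]; ring
  have e1 : {u : I | limitDegree p (u, 1) < unitInterval.symm (rank p (v, 1))} = ∅ := by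
    ext u
    simp only [mem_ofPred_eq, mem_empty_iff_false, iff_false, not_lt]
    rw [← Subtype.coe_le_coe, hx, limitDegree_one]
    nlinarith [mul_nonneg u.2.1 (sub_nonneg.2 p.2.2), mul_nonneg h0.le v.2.1]
  have e2 : {u : I | limitDegree p (u, 0) < unitInterval.symm (rank p (v, 1))} = Ioi v := by
    ext u
    simp only [mem_ofPred_eq, mem_Ioi]
    rw [← Subtype.coe_lt_coe, hx, limitDegree_zero, mul_lt_mul_iff_right₀ h0, sub_lt_sub_iff_left,
      Subtype.coe_lt_coe]
  rw [leftCDF_limitMeasure, e1, e2, measureReal_def, measureReal_def, unitInterval.volume_Ioi,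
    ENNReal.toReal_ofReal (by linarith [v.2.2])]
  simp

/-- One minus the rank is the limiting degree of a dominating vertex arriving at `v`; below it lie
almost all isolated vertices and the dominating ones arriving before `v`. -/
theorem leftCDF_symm_rank_zero {p : I} (h0 : 0 < (p : ℝ)) (h1 : (p : ℝ) < 1) (v : I) :
    leftCDF (limitMeasure p) (unitInterval.symm (rank p (v, 0))) = 1 - p + p * v := by
  have h1' : (0 : ℝ) < 1 - p := by linarith
  have hx : (unitInterval.symm (rank p (v, 0)) : ℝ) = p + (1 - p) * v := by
    rw [unitInterval.coe_symm_eq, rank_zero]; ring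
  have e1 : {u : I | limitDegree p (u, 1) < unitInterval.symm (rank p (v, 0))} = Iio v := by
    ext u
    simp only [mem_ofPred_eq, mem_Iio]
    rw [← Subtype.coe_lt_coe, hx, limitDegree_one,
      show (u : ℝ) + p * (1 - u) = p + (1 - p) * u by ring, add_lt_add_iff_left,
      mul_lt_mul_iff_right₀ h1', Subtype.coe_lt_coe]
  have e2 : (volume : Measure I).real
      {u : I | limitDegree p (u, 0) < unitInterval.symm (rank p (v, 0))} = 1 := by
    refine le_antisymm measureReal_le_one ?_
    -- Time `0` is left out: for `v = 0` an isolated vertex at `u = 0` ties at degree `p`.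
    have hsub : Ioi (0 : I) ⊆
        {u : I | limitDegree p (u, 0) < unitInterval.symm (rank p (v, 0))} := fun u hu => by
      have hu' : (0 : ℝ) < u := hu
      rw [mem_ofPred_eq, ← Subtype.coe_lt_coe, hx, limitDegree_zero]
      nlinarith [mul_pos h0 hu', mul_nonneg h1'.le v.2.1]
    refine le_trans (le_of_eq ?_) (measureReal_mono hsub)
    rw [measureReal_def, unitInterval.volume_Ioi]
    simp
  rw [leftCDF_limitMeasure, e1, e2, measureReal_def, unitInterval.volume_Iio,
    ENNReal.toReal_ofReal v.2.1]
  ring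

theorem mem_setS_zero (x y : I) : (x, y) ∈ setS (limitMeasure 0) ↔ x = 1 ∨ y = 1 := by
  change leftCDF (limitMeasure 0) (unitInterval.symm y) ≤ x ↔ _
  rw [leftCDF, limitMeasure_zero, measureReal_def, Measure.dirac_apply' _ measurableSet_Iio]
  by_cases hy : y = 1
  · subst hy
    simp [x.2.1]
  · have : (0 : I) < unitInterval.symm y := by
      have hlt : (y : ℝ) < 1 := lt_of_le_of_ne y.2.2 fun h => hy (Subtype.ext h)
      rw [← Subtype.coe_lt_coe, unitInterval.coe_symm_eq]
      simpa using hlt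
    rw [indicator_of_mem (mem_Iio.2 this)]
    simp only [Pi.one_apply, ENNReal.toReal_one, hy, or_false]
    exact ⟨fun h => Subtype.ext (le_antisymm x.2.2 h), fun h => by rw [h]; simp⟩

theorem mem_setS_one (x y : I) : (x, y) ∈ setS (limitMeasure 1) := by
  change leftCDF (limitMeasure 1) (unitInterval.symm y) ≤ x
  rw [leftCDF, limitMeasure_one, measureReal_def, Measure.dirac_apply' _ measurableSet_Iio,
    indicator_of_notMem (show (1 : I) ∉ Iio (unitInterval.symm y) from
      not_lt.2 (show unitInterval.symm y ≤ 1 from (unitInterval.symm y).2.2))]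
  simpa using x.2.1

/-- The two affine branches of `rank` cover `[1 - p, 1]` and `[0, 1 - p]`, so questions about `S_μ`
reduce to four combinations of types. -/
theorem exists_rank_eq {p : I} (h0 : 0 < (p : ℝ)) (h1 : (p : ℝ) < 1) (x : I) :
    ∃ u : I, x = rank p (u, 1) ∨ x = rank p (u, 0) := by
  have h1' : (0 : ℝ) < 1 - p := by linarith
  rcases le_total (1 - p : ℝ) x with h | h
  · refine ⟨⟨(x - (1 - p)) / p, div_nonneg (by linarith) h0.le, ?_⟩, Or.inl (Subtype.ext ?_)⟩
    · rw [div_le_one h0]; linarith [x.2.2]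
    · rw [rank_one]; field_simp; ring
  · refine ⟨⟨1 - x / (1 - p), ?_, ?_⟩, Or.inr (Subtype.ext ?_)⟩
    · rw [sub_nonneg, div_le_one h1']; exact h
    · linarith [div_nonneg x.2.1 h1'.le]
    · rw [rank_zero]; field_simp; ring

/-- In rank coordinates `S_μ` reproduces adjacency: two dominating vertices always, two isolated
ones never except at time `0`, mixed pairs when the dominating one is not earlier. -/
theorem mem_setS_rank_one_one {p : I} (h0 : 0 < (p : ℝ)) (h1 : (p : ℝ) < 1) (u v : I) :
    (rank p (u, 1), rank p (v, 1)) ∈ setS (limitMeasure p) := by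
  change leftCDF (limitMeasure p) (unitInterval.symm (rank p (v, 1))) ≤ rank p (u, 1)
  rw [leftCDF_symm_rank_one h0, rank_one]
  nlinarith [mul_nonneg h0.le u.2.1, mul_nonneg (sub_nonneg.2 h1.le) v.2.1]

theorem mem_setS_rank_zero_one {p : I} (h0 : 0 < (p : ℝ)) (h1 : (p : ℝ) < 1) (u v : I) :
    (rank p (u, 0), rank p (v, 1)) ∈ setS (limitMeasure p) ↔ u ≤ v := by
  change leftCDF (limitMeasure p) (unitInterval.symm (rank p (v, 1))) ≤ rank p (u, 0) ↔ _
  rw [leftCDF_symm_rank_one h0, rank_zero, mul_le_mul_iff_right₀ (sub_pos.2 h1),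
    sub_le_sub_iff_left, Subtype.coe_le_coe]

theorem mem_setS_rank_one_zero {p : I} (h0 : 0 < (p : ℝ)) (h1 : (p : ℝ) < 1) (u v : I) :
    (rank p (u, 1), rank p (v, 0)) ∈ setS (limitMeasure p) ↔ v ≤ u := by
  change leftCDF (limitMeasure p) (unitInterval.symm (rank p (v, 0))) ≤ rank p (u, 1) ↔ _
  rw [leftCDF_symm_rank_zero h0 h1, rank_one, add_le_add_iff_left, mul_le_mul_iff_right₀ h0,
    Subtype.coe_le_coe]

theorem mem_setS_rank_zero_zero {p : I} (h0 : 0 < (p : ℝ)) (h1 : (p : ℝ) < 1) (u v : I) :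
    (rank p (u, 0), rank p (v, 0)) ∈ setS (limitMeasure p) ↔ u = 0 ∧ v = 0 := by
  change leftCDF (limitMeasure p) (unitInterval.symm (rank p (v, 0))) ≤ rank p (u, 0) ↔ _
  rw [leftCDF_symm_rank_zero h0 h1, rank_zero]
  have hu := mul_nonneg (sub_nonneg.2 h1.le) u.2.1
  have hv := mul_nonneg h0.le v.2.1
  constructor
  · intro h
    have hu0 : (1 - p : ℝ) * u = 0 := by linarith
    have hv0 : (p : ℝ) * v = 0 := by linarith
    exact ⟨Subtype.ext ((mul_eq_zero.1 hu0).resolve_left (sub_pos.2 h1).ne'),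
      Subtype.ext ((mul_eq_zero.1 hv0).resolve_left h0.ne')⟩
  · rintro ⟨rfl, rfl⟩
    simp

theorem eq_zero_or_eq_one_or (p : I) : p = 0 ∨ p = 1 ∨ (0 < (p : ℝ) ∧ (p : ℝ) < 1) := by
  rcases p.2.1.eq_or_lt with h | h
  · exact Or.inl (Subtype.ext h.symm)
  · rcases p.2.2.eq_or_lt with h' | h'
    · exact Or.inr (Or.inl (Subtype.ext h'))
    · exact Or.inr (Or.inr ⟨h, h'⟩)

theorem limitMeasure_mem_symmMeasures (p : I) : limitMeasure p ∈ symmMeasures := by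
  intro x y
  rcases eq_zero_or_eq_one_or p with rfl | rfl | ⟨h0, h1⟩
  · rw [mem_setS_zero, mem_setS_zero, or_comm]
  · simp only [mem_setS_one]
  · obtain ⟨u, rfl | rfl⟩ := exists_rank_eq h0 h1 x <;>
      obtain ⟨v, rfl | rfl⟩ := exists_rank_eq h0 h1 y
    · simp only [mem_setS_rank_one_one h0 h1]
    · rw [mem_setS_rank_one_zero h0 h1, mem_setS_rank_zero_one h0 h1]
    · rw [mem_setS_rank_one_zero h0 h1, mem_setS_rank_zero_one h0 h1]
    · rw [mem_setS_rank_zero_zero h0 h1, mem_setS_rank_zero_zero h0 h1, and_comm]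

/-- The arrival points outside a null set: the time is positive and the type has positive
probability. -/
def IsGenericArrival (p : I) (z : I × I) : Prop :=
  0 < z.1 ∧ ((z.2 = 1 ∧ 0 < p) ∨ (z.2 = 0 ∧ p < 1))

theorem ae_isGenericArrival (p : I) : ∀ᵐ z ∂(arrivalLaw p), IsGenericArrival p z := by
  have hm : MeasurableSet {z : I × I | IsGenericArrival p z} := by
    have e : {z : I × I | IsGenericArrival p z} = (Prod.fst ⁻¹' Ioi 0) ∩
        ((Prod.snd ⁻¹' {1} ∩ {_z | 0 < p}) ∪ (Prod.snd ⁻¹' {0} ∩ {_z | p < 1})) := rfl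
    rw [e]
    measurability
  rw [ae_iff, ← compl_ofPred, arrivalLaw_apply p hm.compl]
  have hpos : ∀ᵐ u : I, 0 < u := by
    rw [ae_iff]
    have : {u : I | ¬ 0 < u} = {0} := by
      ext u
      simp only [mem_ofPred_eq, mem_singleton_iff]
      exact ⟨fun h => le_antisymm (not_lt.1 h) (unitInterval.nonneg u), fun h => h ▸ lt_irrefl _⟩
    rw [this]
    exact measure_singleton 0
  have hz : ∀ (t : I) (a : ℝ), (0 < a → ((t = 1 ∧ 0 < p) ∨ (t = 0 ∧ p < 1))) →
      ENNReal.ofReal a * volume {u : I | (u, t) ∈ {z : I × I | IsGenericArrival p z}ᶜ} = 0 := by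
    intro t a ha
    by_cases hpa : 0 < a
    · have : (volume : Measure I) {u : I | (u, t) ∈ {z : I × I | IsGenericArrival p z}ᶜ} = 0 := by
        refine measure_mono_null ?_ (ae_iff.1 hpos)
        intro u hu hu0
        exact hu ⟨hu0, ha hpa⟩
      rw [this, mul_zero]
    · rw [ENNReal.ofReal_of_nonpos (not_lt.1 hpa), zero_mul]
  rw [hz 1 p fun h => Or.inl ⟨rfl, h⟩, hz 0 (1 - p) fun h => Or.inr ⟨rfl, Subtype.coe_lt_coe.1 (sub_pos.1 h)⟩, add_zero]

/-- Genericity removes the discrepancies: ties in time, time `0`, and types of probability zero when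
`p` is `0` or `1`. -/
theorem rank_mem_setS_iff_arrivalRel {p : I} {z w : I × I} (hz : IsGenericArrival p z)
    (hw : IsGenericArrival p w) (hne : z.1 ≠ w.1) :
    (rank p z, rank p w) ∈ setS (limitMeasure p) ↔ arrivalRel z w := by
  obtain ⟨u, s⟩ := z
  obtain ⟨v, t⟩ := w
  obtain ⟨hu, hs⟩ := hz
  obtain ⟨hv, ht⟩ := hw
  simp only at hu hs hv ht hne
  have half0 : ¬ (1 / 2 : ℝ) < ((0 : I) : ℝ) := by norm_num
  have half1 : (1 / 2 : ℝ) < ((1 : I) : ℝ) := by norm_num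
  rcases eq_zero_or_eq_one_or p with rfl | rfl | ⟨h0, h1⟩
  · obtain ⟨rfl, -⟩ := hs.resolve_left fun h => lt_irrefl _ h.2
    obtain ⟨rfl, -⟩ := ht.resolve_left fun h => lt_irrefl _ h.2
    rw [mem_setS_zero]
    have hr : ∀ a : I, 0 < a → rank 0 (a, 0) ≠ 1 := fun a ha h => by
      have := congrArg Subtype.val h
      rw [rank_zero] at this
      have ha' : (0 : ℝ) < a := ha
      simp at this
      exact ha.ne' this
    simp only [arrivalRel, hr u hu, hr v hv, half0, and_false, or_self]
  · obtain ⟨rfl, -⟩ := hs.resolve_right fun h => lt_irrefl _ h.2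
    obtain ⟨rfl, -⟩ := ht.resolve_right fun h => lt_irrefl _ h.2
    simp only [mem_setS_one, arrivalRel, half1, and_true, true_iff]
    exact lt_or_gt_of_ne hne
  · rcases hs with ⟨rfl, -⟩ | ⟨rfl, -⟩ <;> rcases ht with ⟨rfl, -⟩ | ⟨rfl, -⟩
    · simp only [mem_setS_rank_one_one h0 h1, arrivalRel, half1, and_true, true_iff]
      exact lt_or_gt_of_ne hne
    · simp only [mem_setS_rank_one_zero h0 h1, arrivalRel, half1, half0, and_true, and_false,
        false_or]
      exact ⟨fun h => lt_of_le_of_ne h hne.symm, le_of_lt⟩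
    · simp only [mem_setS_rank_zero_one h0 h1, arrivalRel, half1, half0, and_true, and_false,
        or_false]
      exact ⟨fun h => lt_of_le_of_ne h hne, le_of_lt⟩
    · simp only [mem_setS_rank_zero_zero h0 h1, arrivalRel, half0, and_false, or_self, iff_false]
      exact fun h => hu.ne' h.1

/-! ### Homomorphism densities -/

theorem ae_pi_ne {k : ℕ} {i j : Fin k} (hij : i ≠ j) :
    ∀ᵐ x : Fin k → I, x i ≠ x j := by
  have hind : IndepFun (fun x : Fin k → I => x i) (fun x => x j) volume :=
    (iIndepFun_pi (μ := fun _ : Fin k => (volume : Measure I)) (X := fun _ => id)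
      fun _ => aemeasurable_id).indepFun hij
  have hm : ∀ l : Fin k, Measurable fun x : Fin k → I => x l := measurable_pi_apply
  have hlaw := (indepFun_iff_map_prod_eq_prod_map_map (hm i).aemeasurable
    (hm j).aemeasurable).1 hind
  have hev : ∀ l : Fin k, (volume : Measure (Fin k → I)).map (fun x => x l) = volume := fun l =>
    (measurePreserving_eval (fun _ : Fin k => (volume : Measure I)) l).map_eq
  rw [hev, hev] at hlaw
  refine ae_of_ae_map (p := fun z : I × I => z.1 ≠ z.2) ((hm i).prodMk (hm j)).aemeasurable ?_
  rw [hlaw, ae_iff]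
  have hd : MeasurableSet {z : I × I | ¬ z.1 ≠ z.2} := by
    simpa using measurableSet_eq_fun measurable_fst measurable_snd
  rw [Measure.measure_prod_null hd]
  refine Eventually.of_forall fun x => ?_
  have : Prod.mk x ⁻¹' {z : I × I | ¬ z.1 ≠ z.2} = {x} := by
    ext y; simp [eq_comm]
  exact (congrArg _ this).trans (measure_singleton x)

theorem measurePreserving_fst_arrivalLaw (p : I) :
    MeasurePreserving Prod.fst (arrivalLaw p) (volume : Measure I) := by
  refine ⟨measurable_fst, Measure.ext fun s hs => ?_⟩
  rw [Measure.map_apply measurable_fst hs, arrivalLaw_apply p (measurable_fst hs)]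
  simp only [mem_preimage, ofPred_mem_eq]
  rw [← add_mul, ← ENNReal.ofReal_add p.2.1 (by linarith [p.2.2])]
  simp

theorem ae_generic (p : I) (k : ℕ) : ∀ᵐ z ∂(Measure.pi fun _ : Fin k => arrivalLaw p),
    (∀ i, IsGenericArrival p (z i)) ∧ ∀ i j, i ≠ j → (z i).1 ≠ (z j).1 := by
  have h1 : ∀ i : Fin k, ∀ᵐ z ∂(Measure.pi fun _ : Fin k => arrivalLaw p),
      IsGenericArrival p (z i) := fun i =>
    (measurePreserving_eval (fun _ : Fin k => arrivalLaw p) i).quasiMeasurePreserving.ae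
      (ae_isGenericArrival p)
  have h2 : ∀ i j : Fin k, ∀ᵐ z ∂(Measure.pi fun _ : Fin k => arrivalLaw p),
      i ≠ j → (z i).1 ≠ (z j).1 := fun i j => by
    by_cases hij : i = j
    · exact Eventually.of_forall fun _ h => absurd hij h
    · have := (measurePreserving_pi (fun _ : Fin k => arrivalLaw p) (fun _ => (volume : Measure I))
        fun _ => measurePreserving_fst_arrivalLaw p).quasiMeasurePreserving.ae (ae_pi_ne hij)
      filter_upwards [this] with z hz _ using hz
  exact (ae_all_iff.2 h1).and (ae_all_iff.2 fun i => ae_all_iff.2 (h2 i))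

/-- The tuples of arrival points which form a homomorphic image of `F`. -/
def homSet {k : ℕ} (F : SimpleGraph (Fin k)) : Set (Fin k → I × I) :=
  {z | ∀ i j, F.Adj i j → arrivalRel (z i) (z j)}

theorem continuous_time {k : ℕ} (i : Fin k) : Continuous fun z : Fin k → I × I => (z i).1 := by
  fun_prop

theorem continuous_type {k : ℕ} (i : Fin k) :
    Continuous fun z : Fin k → I × I => ((z i).2 : ℝ) := by
  fun_prop

/-- Comparing types with `1 / 2` instead of equating them with `1` makes the relation open. -/
theorem isOpen_homSet {k : ℕ} (F : SimpleGraph (Fin k)) : IsOpen (homSet F) := by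
  have e : homSet F = ⋂ i, ⋂ j, ⋂ _ : F.Adj i j, {z | arrivalRel (z i) (z j)} := by
    ext z; simp [homSet]
  rw [e]
  refine isOpen_iInter_of_finite fun i => isOpen_iInter_of_finite fun j =>
    isOpen_iInter_of_finite fun _ => ?_
  exact ((isOpen_lt (continuous_time i) (continuous_time j)).inter
    (isOpen_lt continuous_const (continuous_type j))).union
    ((isOpen_lt (continuous_time j) (continuous_time i)).inter
      (isOpen_lt continuous_const (continuous_type i)))

/-- The open set `A'` of tuples with an edge whose later end has type below `1 / 2` is disjoint from
`homSet F`, hence from its closure. A generic tuple lies in one of the two, so the frontier contains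
no generic tuple. -/
theorem measure_frontier_homSet (p : I) {k : ℕ} (F : SimpleGraph (Fin k)) :
    (Measure.pi fun _ : Fin k => arrivalLaw p) (frontier (homSet F)) = 0 := by
  set A' : Set (Fin k → I × I) := {z | ∃ i j, F.Adj i j ∧
    (((z i).1 < (z j).1 ∧ ((z j).2 : ℝ) < 1 / 2) ∨ ((z j).1 < (z i).1 ∧ ((z i).2 : ℝ) < 1 / 2))}
    with hA'
  have hopen : IsOpen A' := by
    have e : A' = ⋃ i, ⋃ j, ⋃ _ : F.Adj i j, {z |
        ((z i).1 < (z j).1 ∧ ((z j).2 : ℝ) < 1 / 2) ∨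
          ((z j).1 < (z i).1 ∧ ((z i).2 : ℝ) < 1 / 2)} := by
      ext z; simp [hA']
    rw [e]
    refine isOpen_iUnion fun i => isOpen_iUnion fun j => isOpen_iUnion fun _ => ?_
    exact ((isOpen_lt (continuous_time i) (continuous_time j)).inter
      (isOpen_lt (continuous_type j) continuous_const)).union
      ((isOpen_lt (continuous_time j) (continuous_time i)).inter
        (isOpen_lt (continuous_type i) continuous_const))
  have hdisj : Disjoint (homSet F) A' := by
    rw [Set.disjoint_left]
    rintro z hz ⟨i, j, hij, h⟩
    rcases hz i j hij with ⟨ha, hb⟩ | ⟨ha, hb⟩ <;> rcases h with ⟨hc, hd⟩ | ⟨hc, hd⟩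
    · linarith
    · exact lt_asymm ha hc
    · exact lt_asymm ha hc
    · linarith
  have hclos : Disjoint (closure (homSet F)) A' := hdisj.closure_left hopen
  refine measure_mono_null ?_ (ae_iff.1 (ae_generic p k))
  intro z hz hgen
  obtain ⟨hg, hne⟩ := hgen
  rw [(isOpen_homSet F).frontier_eq] at hz
  obtain ⟨hz1, hz2⟩ := hz
  refine Set.disjoint_left.1 hclos hz1 ?_
  simp only [homSet, mem_ofPred_eq, not_forall] at hz2
  obtain ⟨i, j, hij, hnot⟩ := hz2
  refine ⟨i, j, hij, ?_⟩
  have htype : ∀ l : Fin k, ¬ (1 / 2 : ℝ) < (z l).2 → ((z l).2 : ℝ) < 1 / 2 := fun l hl => by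
    rcases (hg l).2 with ⟨h, -⟩ | ⟨h, -⟩
    · rw [h] at hl; norm_num at hl
    · rw [h]; norm_num
  simp only [arrivalRel, not_or, not_and] at hnot
  rcases lt_or_gt_of_ne (hne i j hij.ne) with h | h
  · exact Or.inl ⟨h, htype j (hnot.1 h)⟩
  · exact Or.inr ⟨h, htype i (hnot.2 h)⟩

theorem homDensity_seqGraph (dom : ℕ → Bool) (n : ℕ) {k : ℕ} (F : SimpleGraph (Fin k)) :
    homDensity F (seqGraph dom n) =
      (Measure.pi fun _ : Fin k =>
        (empirical (arrivalPoint dom n) : Measure (I × I))).real (homSet F) := by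
  rw [pi_empirical_real _ (isOpen_homSet F).measurableSet, homDensity]
  congr 2
  refine Nat.card_congr ⟨fun f => ⟨f, fun i j h =>
      (seqGraph_adj_iff_arrivalRel dom n _ _).1 (f.map_adj h)⟩,
    fun x => ⟨x.1, fun {i j} h => (seqGraph_adj_iff_arrivalRel dom n _ _).2 (x.2 i j h)⟩,
    fun _ => rfl, fun _ => rfl⟩

theorem measurableSet_forall_mem_setS (μ : ProbabilityMeasure I) {k : ℕ}
    (F : SimpleGraph (Fin k)) :
    MeasurableSet {x : Fin k → I | ∀ i j, F.Adj i j → (x i, x j) ∈ setS μ} := by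
  have e : {x : Fin k → I | ∀ i j, F.Adj i j → (x i, x j) ∈ setS μ} =
      ⋂ i, ⋂ j, ⋂ _ : F.Adj i j, (fun x : Fin k → I => (x i, x j)) ⁻¹' setS μ := by
    ext x; simp
  rw [e]
  exact MeasurableSet.iInter fun i => MeasurableSet.iInter fun j => MeasurableSet.iInter fun _ =>
    ((measurable_pi_apply i).prodMk (measurable_pi_apply j)) (measurableSet_setS μ)

open Classical in
-- A product of indicators is the indicator of an intersection; symmetry of `S_μ` lets the edges
-- with `e.1 < e.2` account for both orientations.
theorem homDensity_graphonOf (μ : ProbabilityMeasure I) (hμ : μ ∈ symmMeasures) {k : ℕ}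
    (F : SimpleGraph (Fin k)) :
    (graphonOf μ hμ).homDensity F =
      (volume : Measure (Fin k → I)).real {x | ∀ i j, F.Adj i j → (x i, x j) ∈ setS μ} := by
  have hm := measurableSet_forall_mem_setS μ F
  rw [← integral_indicator_one hm]
  refine integral_congr_ae (Eventually.of_forall fun x => ?_)
  have hite : ∀ e : Fin k × Fin k, (((graphonOf μ hμ).toFun (x e.1) (x e.2) : I) : ℝ) =
      if (x e.1, x e.2) ∈ setS μ then 1 else 0 := fun e => by
    simp only [graphonOf]; split_ifs <;> rfl
  simp only [hite, Finset.prod_ite_zero, Finset.prod_const_one, indicator_apply, mem_ofPred_eq,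
    Pi.one_apply, Finset.mem_filter, Finset.mem_univ, true_and]
  congr 1
  refine propext ⟨fun h i j hij => ?_, fun h e he => h _ _ he.2⟩
  rcases lt_or_gt_of_ne hij.ne with hlt | hlt
  · exact h (i, j) ⟨hlt, hij⟩
  · exact (hμ _ _).2 (h (j, i) ⟨hlt, hij.symm⟩)

theorem homDensity_limitMeasure (p : I) {k : ℕ} (F : SimpleGraph (Fin k)) :
    (graphonOf (limitMeasure p) (limitMeasure_mem_symmMeasures p)).homDensity F =
      (Measure.pi fun _ : Fin k => arrivalLaw p).real (homSet F) := by
  have hmp := measurePreserving_pi (fun _ : Fin k => arrivalLaw p) (fun _ => (volume : Measure I))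
    fun _ => measurePreserving_rank p
  have hm := measurableSet_forall_mem_setS (limitMeasure p) F
  rw [homDensity_graphonOf, volume_pi, ← hmp.measureReal_preimage hm.nullMeasurableSet]
  refine measureReal_congr ?_
  filter_upwards [ae_generic p k] with z hz
  refine propext (forall_congr' fun i => forall_congr' fun j => imp_congr_right fun hij => ?_)
  exact rank_mem_setS_iff_arrivalRel (hz.1 i) (hz.1 j) (hz.2 i j hij.ne)

/-- Products of weakly convergent laws converge weakly, and the null frontier of `homSet F` permits
evaluating on it. -/
theorem tendsto_homDensity_seqGraph {dom : ℕ → Bool} {p : I}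
    (h : Tendsto (fun n : ℕ => (∑ i ∈ Finset.range n, vertexType dom i) / n) atTop (𝓝 (p : ℝ)))
    {k : ℕ} (F : SimpleGraph (Fin k)) :
    Tendsto (fun n : ℕ => homDensity F (seqGraph dom n)) atTop
      (𝓝 ((graphonOf (limitMeasure p) (limitMeasure_mem_symmMeasures p)).homDensity F)) := by
  have hpi : Tendsto (fun n : ℕ => ProbabilityMeasure.pi
      fun _ : Fin k => empirical (arrivalPoint dom n)) atTop
      (𝓝 (ProbabilityMeasure.pi fun _ : Fin k => arrivalProb p)) :=
    (ProbabilityMeasure.continuous_pi.tendsto _).comp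
      (tendsto_pi_nhds.2 fun _ => tendsto_empirical_arrivalPoint h)
  have hfr : (ProbabilityMeasure.pi fun _ : Fin k => arrivalProb p) (frontier (homSet F)) = 0 := by
    rw [ProbabilityMeasure.null_iff_toMeasure_null]
    exact measure_frontier_homSet p F
  have := (NNReal.continuous_coe.tendsto _).comp
    (ProbabilityMeasure.tendsto_measure_of_null_frontier_of_tendsto hpi hfr)
  rw [homDensity_limitMeasure]
  simp only [homDensity_seqGraph]
  exact this

/-! ### Convergence in the space of graph limits -/

theorem tendsto_profile_seqGraph {dom : ℕ → Bool} {p : I}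
    (h : Tendsto (fun n : ℕ => (∑ i ∈ Finset.range n, vertexType dom i) / n) atTop (𝓝 (p : ℝ))) :
    Tendsto (fun n : ℕ => profile (seqGraph dom n)) atTop
      (𝓝 (limitOf (limitMeasure p) (limitMeasure_mem_symmMeasures p))) := by
  refine Tendsto.prodMk_nhds (tendsto_pi_nhds.2 fun F => tendsto_homDensity_seqGraph h F.2) ?_
  have := (tendsto_add_atTop_iff_nat 1).2 (tendsto_inv_atTop_nhds_zero_nat (𝕜 := ℝ))
  exact this.congr fun n => by rw [Fintype.card_fin]

theorem thresholdGraphs_subset_graphs : thresholdGraphs ⊆ graphs :=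
  fun _ ⟨n, G, _, hx⟩ => ⟨n, G, hx⟩

/-- The coordinate `1 / v` vanishes at a limit but at no finite graph. -/
theorem graphonLimit_notMem_graphs (W : Graphon) : W.limit ∉ graphs := by
  rintro ⟨n, G, h⟩
  have := congrArg Prod.snd h
  simp only [Graphon.limit, profile, Fintype.card_fin] at this
  exact (inv_ne_zero (by positivity : ((n + 1 : ℕ) : ℝ) ≠ 0)) this.symm

theorem mem_thresholdLimits_of_tendsto {G : (n : ℕ) → SimpleGraph (Fin (n + 1))}
    (hG : ∀ n, IsThreshold (G n)) {W : Graphon}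
    (h : Tendsto (fun n => profile (G n)) atTop (𝓝 W.limit)) : W.limit ∈ thresholdLimits := by
  have hcl : W.limit ∈ closure thresholdGraphs :=
    mem_closure_of_tendsto h (Eventually.of_forall fun n => ⟨n, G n, hG n, rfl⟩)
  exact ⟨hcl, closure_mono thresholdGraphs_subset_graphs hcl, graphonLimit_notMem_graphs W⟩

/-! ### The law of large numbers for the types -/

theorem ae_tendsto_average {Ω : Type*} [MeasurableSpace Ω] {P : Measure Ω} [IsProbabilityMeasure P]
    {p : ℝ} (hp : 0 ≤ p) {dom : ℕ → Ω → Bool} (hmeas : ∀ k, Measurable (dom k))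
    (hindep : iIndepFun dom P) (hlaw : ∀ k, P {ω | dom k ω = true} = ENNReal.ofReal p) :
    ∀ᵐ ω ∂P, Tendsto
      (fun n : ℕ => (∑ k ∈ Finset.range n, if dom k ω = true then (1 : ℝ) else 0) / n)
      atTop (𝓝 p) := by
  set φ : Bool → ℝ := fun b => if b = true then 1 else 0
  have hφ : Measurable φ := measurable_of_countable _
  have hident : ∀ k, IdentDistrib (dom k) (dom 0) P P := fun k => by
    refine ⟨(hmeas k).aemeasurable, (hmeas 0).aemeasurable, ?_⟩
    have htrue : ∀ l, (P.map (dom l)) {true} = ENNReal.ofReal p := fun l => by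
      rw [Measure.map_apply (hmeas l) (measurableSet_singleton _)]
      exact hlaw l
    have hfalse : ∀ l, (P.map (dom l)) {false} = 1 - ENNReal.ofReal p := fun l => by
      have := Measure.isProbabilityMeasure_map (μ := P) (hmeas l).aemeasurable
      rw [← htrue l, ← prob_compl_eq_one_sub (measurableSet_singleton _)]
      congr 1
      ext b; cases b <;> simp
    -- A law on `Bool` is determined by its mass at `true`, so the types are identically
    -- distributed.
    refine Measure.ext_of_singleton fun b => ?_
    cases b
    · rw [hfalse, hfalse]
    · rw [htrue, htrue]
  have hmean : ∫ ω, φ (dom 0 ω) ∂P = p := by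
    have hind : (fun ω => φ (dom 0 ω)) = {ω | dom 0 ω = true}.indicator 1 := by
      ext ω; simp [φ, indicator_apply]
    have hm : MeasurableSet {ω | dom 0 ω = true} := hmeas 0 (measurableSet_singleton true)
    rw [hind, integral_indicator_one hm, measureReal_def,
      hlaw, ENNReal.toReal_ofReal hp]
  have hint : Integrable (fun ω => φ (dom 0 ω)) P :=
    Integrable.of_bound (hφ.comp (hmeas 0)).aestronglyMeasurable 1
      (Eventually.of_forall fun ω => by simp only [φ]; split_ifs <;> simp)
  have := strong_law_ae_real (fun k ω => φ (dom k ω)) hint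
    (fun i j hij => (hindep.indepFun hij).comp hφ hφ) fun k => (hident k).comp hφ
  rwa [hmean] at this

end ThresholdLimit

theorem theorem6p4 {Ω : Type*} [MeasurableSpace Ω] (P : Measure Ω) [IsProbabilityMeasure P]
    (p : ℝ) (hp : p ∈ Set.Icc (0 : ℝ) 1)
    -- `dom k` tells whether the `k`-th added vertex is dominating
    (dom : ℕ → Ω → Bool) (hmeas : ∀ k, Measurable (dom k)) (hindep : iIndepFun dom P)
    (hlaw : ∀ k, P {ω | dom k ω = true} = ENNReal.ofReal p) :
    ∃ μ : ProbabilityMeasure I,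
      (0 < p → p < 1 → (μ : Measure I) = (volume : Measure I).withDensity
        (fun x => ENNReal.ofReal (if (x : ℝ) < p then (1 - p) / p else p / (1 - p)))) ∧
      (p = 0 → (μ : Measure I) = Measure.dirac 0) ∧
      (p = 1 → (μ : Measure I) = Measure.dirac 1) ∧
      (p = 1 / 2 → (μ : Measure I) = volume) ∧
      (∀ᵐ ω ∂P, Tendsto
        (fun n : ℕ => ThresholdLimit.degreeDist (ThresholdLimit.seqGraph (fun k => dom k ω) n))
        atTop (𝓝 μ)) ∧
      ∃ hμ : μ ∈ ThresholdLimit.symmMeasures,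
        ThresholdLimit.limitOf μ hμ ∈ ThresholdLimit.thresholdLimits ∧
        ∀ᵐ ω ∂P, Tendsto
          (fun n : ℕ => ThresholdLimit.profile (ThresholdLimit.seqGraph (fun k => dom k ω) n))
          atTop (𝓝 (ThresholdLimit.limitOf μ hμ)) := by
  -- The only probabilistic input; both almost sure convergences hold on this event.
  have hae : ∀ᵐ ω ∂P, Tendsto (fun n : ℕ =>
      (∑ i ∈ Finset.range n, ThresholdLimit.vertexType (fun k => dom k ω) i) / n) atTop (𝓝 p) := by
    filter_upwards [ThresholdLimit.ae_tendsto_average hp.1 hmeas hindep hlaw] with ω hω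
    exact ThresholdLimit.tendsto_average_vertexType hω
  obtain ⟨q, rfl⟩ : ∃ q : I, (q : ℝ) = p := ⟨⟨p, hp⟩, rfl⟩
  have hprofile : ∀ᵐ ω ∂P, Tendsto
      (fun n : ℕ => ThresholdLimit.profile (ThresholdLimit.seqGraph (fun k => dom k ω) n)) atTop
      (𝓝 (ThresholdLimit.limitOf _ (ThresholdLimit.limitMeasure_mem_symmMeasures q))) := by
    filter_upwards [hae] with ω hω
    exact ThresholdLimit.tendsto_profile_seqGraph hω
  refine ⟨ThresholdLimit.limitMeasure q, ThresholdLimit.limitMeasure_eq_withDensity,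
    fun h => ?_, fun h => ?_, ThresholdLimit.limitMeasure_half, ?_,
    ThresholdLimit.limitMeasure_mem_symmMeasures q, ?_, hprofile⟩
  · obtain rfl : q = 0 := Subtype.ext h
    exact ThresholdLimit.limitMeasure_zero
  · obtain rfl : q = 1 := Subtype.ext h
    exact ThresholdLimit.limitMeasure_one
  · filter_upwards [hae] with ω hω
    exact ThresholdLimit.tendsto_degreeDist_seqGraph hω
  -- A single good sample path already supplies a deterministic sequence of threshold graphs
  -- converging to the limit.
  · obtain ⟨ω, hω⟩ := hprofile.exists
    exact ThresholdLimit.mem_thresholdLimits_of_tendsto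
      (fun n => ThresholdLimit.isThreshold_seqGraph _ n) hω
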